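/- Let $(W,S)$ be an arbitrary Coxeter system ($S$ may be infinite), with length function $l$ and identity $1$, ordered by the Bruhat order: $v\le w$ if and only if some reduced word for $w$ has a (not necessarily contiguous) subword that is a reduced word for $v$. For a finite graded poset $P$ with $\hat 0$ and $\hat 1$ of rank $n+1$, and for $S'\subseteq[n]=\{1,\dots,n\}$, let $\alpha_P(S')$ be the number of chains of $P$ whose set of ranks is $S'$, and let $\beta_P(S')=\sum_{T\subseteq S'}(-1)^{|S'\setminus T|}\alpha_P(T)$. The ab-index of $P$ is $\Psi_P(a,b)=\sum_{S'\subseteq[n]}\beta_P(S')\,u_1\cdots u_n\in\mathbb Z\langle a,b\rangle$, where $u_i=b$ if $i\in S'$ and $u_i=a$ otherwise (for a one-element poset set $\Psi_P=1$). If $\Psi_P$ can be written as a noncommutative polynomial with integer coefficients in $c=a+b$ and $d=ab+ba$ in exactly one way, this polynomial $\Phi_P\in\mathbb Z\langle c,d\rangle$ is called the cd-index of $P$. Let $B_n$ be the Boolean algebra of rank $n$, that is, the poset of all subsets of an $n$-element set. Theorem. Assume that for all $u\le v$ in $W$ the coefficients of the cd-index $\Phi_{[u,v]}$ of the Bruhat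 interval $[u,v]$ are nonnegative. Then for every $w\in W$ the posets $[1,w]$ and $B_{l(w)}$ have cd-indices, and $$\Phi_{[1,w]}\le\Phi_{B_{l(w)}}$$ coefficientwise, i.e. for every monomial $m$ in $c$ and $d$ the coefficient of $m$ in $\Phi_{[1,w]}$ is at most the coefficient of $m$ in $\Phi_{B_{l(w)}}$. -/

import Mathlib

/-! ### Bruhat order -/

namespace CoxeterSystem

variable {B W : Type*} [Group W] {M : CoxeterMatrix B} (cs : CoxeterSystem M W)

/-- The Bruhat order of a Coxeter system through the subword property: `v ≤ w` if some reduced word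
for `w` has a subword that is a reduced word for `v`. -/
def BruhatLE (v w : W) : Prop :=
  ∃ ω : List B, cs.IsReduced ω ∧ cs.wordProd ω = w ∧
    ∃ η : List B, η.Sublist ω ∧ cs.IsReduced η ∧ cs.wordProd η = v

/-! The next lemmas serve only to show that `BruhatLE` is a partial order. -/

open Classical in
/-- The action of a simple reflection on `W × ℤ/2` that keeps track of inversions. -/
noncomputable def inversionStep (i : B) : Function.End (W × ZMod 2) := fun p =>
  (cs.simple i * p.1 * cs.simple i, p.2 + if p.1 = cs.simple i then 1 else 0)

open Classical in
theorem inversionStep_mul_pow (i j : B) (m : ℕ) (p : W × ZMod 2) :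
    ((cs.inversionStep i * cs.inversionStep j) ^ m) p =
      ((cs.simple i * cs.simple j) ^ m * p.1 * ((cs.simple i * cs.simple j) ^ m)⁻¹,
        p.2 + ∑ k ∈ Finset.range (2 * m),
          if p.1 = cs.simple j * (cs.simple i * cs.simple j) ^ k then 1 else 0) := by
  have hc : ∀ k : ℕ, cs.simple j * (cs.simple i * cs.simple j) ^ k * cs.simple j
      = ((cs.simple i * cs.simple j) ^ k)⁻¹ := by
    intro k
    induction k with
    | zero => simp
    | succ k ih =>
      have h : ((cs.simple i * cs.simple j) ^ (k + 1))⁻¹ =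
          ((cs.simple i * cs.simple j) ^ k)⁻¹ * (cs.simple i * cs.simple j)⁻¹ := by
        rw [pow_succ', mul_inv_rev]
      rw [h, ← ih, pow_succ]
      simp [mul_assoc]
  induction m with
  | zero => simp; rfl
  | succ m ih =>
    rw [pow_succ', show 2 * (m + 1) = 2 * m + 1 + 1 by ring, Finset.sum_range_succ,
      Finset.sum_range_succ]
    change cs.inversionStep i (cs.inversionStep j (((cs.inversionStep i * cs.inversionStep j) ^ m) p)) = _
    rw [ih]
    set x := cs.simple i * cs.simple j with hx
    have h1 : (x ^ m * p.1 * (x ^ m)⁻¹ = cs.simple j) ↔ p.1 = cs.simple j * x ^ (2 * m) := by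
      have : cs.simple j * x ^ (2 * m) = (x ^ m)⁻¹ * cs.simple j * x ^ m := by
        rw [← hc m]; simp [mul_assoc, two_mul, pow_add]
      rw [this]
      constructor
      · intro h; rw [← h]; group
      · intro h; rw [h]; group
    have h2 : (cs.simple j * (x ^ m * p.1 * (x ^ m)⁻¹) * cs.simple j = cs.simple i) ↔
        p.1 = cs.simple j * x ^ (2 * m + 1) := by
      have : cs.simple j * x ^ (2 * m + 1) =
          (x ^ m)⁻¹ * (cs.simple j)⁻¹ * cs.simple i * (cs.simple j)⁻¹ * x ^ m := by
        rw [← hc m, show 2 * m + 1 = m + 1 + m by ring, pow_add, pow_add]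
        simp [mul_assoc, hx]
      rw [this]
      constructor
      · intro h; rw [← h]; group
      · intro h; rw [h]; group
    unfold inversionStep
    simp only [h1, h2, add_assoc]
    refine Prod.ext ?_ rfl
    simp [pow_succ', hx, mul_assoc]

theorem isLiftable_inversionStep : M.IsLiftable cs.inversionStep := by
  classical
  intro i j
  funext p
  rw [inversionStep_mul_pow, cs.simple_mul_simple_pow, two_mul, Finset.sum_range_add]
  simp only [pow_add, cs.simple_mul_simple_pow, one_mul, inv_one, mul_one, CharTwo.add_self_eq_zero,
    add_zero]
  rfl

open Classical in
theorem lift_inversionStep_wordProd (ω : List B) (p : W × ZMod 2) :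
    cs.lift ⟨cs.inversionStep, cs.isLiftable_inversionStep⟩ (cs.wordProd ω) p =
      (cs.wordProd ω * p.1 * (cs.wordProd ω)⁻¹, p.2 + ((cs.rightInvSeq ω).count p.1 : ℕ)) := by
  induction ω with
  | nil => simp; rfl
  | cons i ω ih =>
    rw [wordProd_cons, map_mul, lift_apply_simple]
    change cs.inversionStep i (cs.lift ⟨cs.inversionStep, cs.isLiftable_inversionStep⟩ (cs.wordProd ω) p) = _
    rw [ih]
    unfold inversionStep
    have h : (cs.wordProd ω * p.1 * (cs.wordProd ω)⁻¹ = cs.simple i) ↔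
        ((cs.wordProd ω)⁻¹ * cs.simple i * cs.wordProd ω = p.1) := by
      constructor
      · intro h; rw [← h]; group
      · intro h; rw [← h]; group
    refine Prod.ext ?_ ?_
    · simp [mul_assoc]
    · simp only [h, rightInvSeq, List.count_cons, beq_iff_eq]
      push_cast
      rw [add_assoc]

/-- The strong exchange property. -/
theorem exists_eraseIdx_of_isRightInversion (ω : List B) (t : W)
    (h : cs.IsRightInversion (cs.wordProd ω) t) :
    ∃ j < ω.length, cs.wordProd ω * t = cs.wordProd (ω.eraseIdx j) := by
  classical
  set φ := cs.lift ⟨cs.inversionStep, cs.isLiftable_inversionStep⟩ with hφ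
  have hfst : ∀ (w : W) (p : W × ZMod 2), (φ w p).1 = w * p.1 * w⁻¹ := by
    intro w p
    obtain ⟨η, rfl⟩ := cs.wordProd_surjective w
    rw [hφ, lift_inversionStep_wordProd]
  have hadd : ∀ (w : W) (x : W) (ε : ZMod 2), (φ w (x, ε)).2 = ε + (φ w (x, 0)).2 := by
    intro w x ε
    obtain ⟨η, rfl⟩ := cs.wordProd_surjective w
    rw [hφ, lift_inversionStep_wordProd, lift_inversionStep_wordProd]
    simp
  have hmul : ∀ (u v x : W),
      (φ (u * v) (x, 0)).2 = (φ v (x, 0)).2 + (φ u (v * x * v⁻¹, 0)).2 := by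
    intro u v x
    rw [map_mul]
    change (φ u (φ v (x, 0))).2 = _
    rw [← hadd, ← hfst v (x, 0)]
  have hone : ∀ (w x : W), (φ w (x, 0)).2 = 1 → cs.length (w * x) < cs.length w := by
    intro w x hx
    obtain ⟨η, hη, rfl⟩ := cs.exists_isReduced w
    rw [hφ, lift_inversionStep_wordProd] at hx
    have : x ∈ cs.rightInvSeq η := by
      by_contra hn
      rw [List.count_eq_zero_of_not_mem hn] at hx
      simp at hx
    exact (cs.isRightInversion_of_mem_rightInvSeq hη this).2
  have hsimple : ∀ i : B, (φ (cs.simple i) (cs.simple i, 0)).2 = 1 := by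
    intro i
    rw [hφ, lift_apply_simple]
    simp [inversionStep]
  obtain ⟨ht, hlt⟩ := h
  have htt : (φ t (t, 0)).2 = 1 := by
    obtain ⟨w, i, rfl⟩ := ht
    have h0 := hmul w⁻¹ w (cs.simple i)
    have h1 := hmul (w * cs.simple i) w⁻¹ (w * cs.simple i * w⁻¹)
    have h2 := hmul w (cs.simple i) (cs.simple i)
    have e1 : w⁻¹ * (w * cs.simple i * w⁻¹) * w⁻¹⁻¹ = cs.simple i := by group
    have e2 : cs.simple i * cs.simple i * (cs.simple i)⁻¹ = cs.simple i := by group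
    rw [e1] at h1
    rw [e2, hsimple] at h2
    have h3 : (φ (w⁻¹ * w) (cs.simple i, 0)).2 = 0 := by
      rw [inv_mul_cancel, map_one]; rfl
    rw [h1, h2]
    rw [h3] at h0
    linear_combination -h0
  have hmem : t ∈ cs.rightInvSeq ω := by
    by_contra hn
    have h0 : (φ (cs.wordProd ω) (t, 0)).2 = 0 := by
      rw [hφ, lift_inversionStep_wordProd, List.count_eq_zero_of_not_mem hn]
      simp
    have h1 := hmul (cs.wordProd ω) t t
    rw [htt, show t * t * t⁻¹ = t by group, h0, add_zero] at h1
    have h2 := hone _ _ h1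
    rw [mul_assoc, ht.mul_self, mul_one] at h2
    omega
  obtain ⟨j, hj, hjt⟩ := List.mem_iff_getElem.mp hmem
  refine ⟨j, by simpa using hj, ?_⟩
  rw [← wordProd_mul_getD_rightInvSeq, List.getD_eq_getElem _ 1 hj, hjt]

theorem exists_reduced_sublist (ω : List B) :
    ∃ η : List B, η.Sublist ω ∧ cs.IsReduced η ∧ cs.wordProd η = cs.wordProd ω := by
  induction ω with
  | nil => exact ⟨[], by simp, by simp [IsReduced], rfl⟩
  | cons i ω ih =>
    obtain ⟨η, hs, hr, hp⟩ := ih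
    rcases cs.length_simple_mul (cs.wordProd η) i with h | h
    · refine ⟨i :: η, hs.cons_cons i, ?_, by rw [wordProd_cons, wordProd_cons, hp]⟩
      rw [IsReduced, wordProd_cons, h, hr.eq, List.length_cons]
    · have e : cs.wordProd η * ((cs.wordProd η)⁻¹ * cs.simple i * cs.wordProd η) =
          cs.simple i * cs.wordProd η := by group
      obtain ⟨j, hj, hj'⟩ := cs.exists_eraseIdx_of_isRightInversion η
        ((cs.wordProd η)⁻¹ * cs.simple i * cs.wordProd η)
        ⟨⟨(cs.wordProd η)⁻¹, i, by group⟩, by rw [e]; omega⟩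
      rw [e] at hj'
      refine ⟨η.eraseIdx j, ((List.eraseIdx_sublist η j).trans hs).cons i, ?_, ?_⟩
      · rw [IsReduced, ← hj']
        have := List.length_eraseIdx_add_one hj
        have := hr.eq
        omega
      · rw [← hj', wordProd_cons, hp]

/-- One step upwards along a reflection. -/
def BruhatStep (u v : W) : Prop :=
  ∃ t, cs.IsReflection t ∧ v = u * t ∧ cs.length u < cs.length v

theorem exists_sublist_of_reflTransGen {u v : W} (h : Relation.ReflTransGen cs.BruhatStep u v) :
    ∀ ω : List B, cs.wordProd ω = v → ∃ η : List B, η.Sublist ω ∧ cs.wordProd η = u := by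
  induction h with
  | refl => exact fun ω h => ⟨ω, List.Sublist.refl ω, h⟩
  | @tail b c _ hstep ih =>
    intro ω hω
    obtain ⟨t, ht, hc, hlt⟩ := hstep
    have hb : b = c * t := by rw [hc, mul_assoc, ht.mul_self, mul_one]
    obtain ⟨j, -, hj⟩ := cs.exists_eraseIdx_of_isRightInversion ω t
      ⟨ht, by rw [hω, ← hb]; exact hlt⟩
    obtain ⟨η, hs, hη⟩ := ih (ω.eraseIdx j) (by rw [← hj, hω, hb])
    exact ⟨η, hs.trans (List.eraseIdx_sublist ω j), hη⟩

theorem reflTransGen_simple_mul {u v : W} (i : B) (h : Relation.ReflTransGen cs.BruhatStep u v) :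
    Relation.ReflTransGen cs.BruhatStep (cs.simple i * u) v ∨
      Relation.ReflTransGen cs.BruhatStep (cs.simple i * u) (cs.simple i * v) := by
  induction h with
  | refl => exact Or.inr .refl
  | @tail b c _ hstep ih =>
    rcases ih with ih | ih
    · exact Or.inl (ih.tail hstep)
    obtain ⟨t, ht, hc, hlt⟩ := hstep
    by_cases hl : cs.length (cs.simple i * b) < cs.length (cs.simple i * c)
    · exact Or.inr (ih.tail ⟨t, ht, by rw [hc, mul_assoc], hl⟩)
    have hne : cs.length (cs.simple i * c) ≠ cs.length (cs.simple i * b) := by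
      rw [hc, ← mul_assoc]; exact ht.length_mul_left_ne _
    have hsb := cs.length_simple_mul b i
    have hsc := cs.length_simple_mul c i
    obtain ⟨η, hη, hcη⟩ := cs.exists_isReduced (cs.simple i * c)
    have hc' : cs.wordProd (i :: η) = c := by
      rw [wordProd_cons, ← hcη, simple_mul_simple_cancel_left]
    have hb : b = c * t := by rw [hc, mul_assoc, ht.mul_self, mul_one]
    obtain ⟨j, hj, hj'⟩ := cs.exists_eraseIdx_of_isRightInversion (i :: η) t
      ⟨ht, by rw [hc', ← hb]; exact hlt⟩
    rw [hc', ← hb] at hj'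
    cases j with
    | zero =>
      rw [List.eraseIdx_cons_zero, ← hcη] at hj'
      have : cs.simple i * b = c := by rw [hj', simple_mul_simple_cancel_left]
      left
      rw [← this]
      exact ih
    | succ j =>
      rw [List.eraseIdx_cons_succ, wordProd_cons] at hj'
      have h1 : cs.simple i * b = cs.wordProd (η.eraseIdx j) := by
        rw [hj', simple_mul_simple_cancel_left]
      have h2 := cs.length_wordProd_le (η.eraseIdx j)
      have h3 := List.length_eraseIdx_add_one (show j < η.length by simpa using hj)
      have h4 := hη.eq
      rw [← hcη] at h4
      rw [← h1] at h2
      omega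

theorem reflTransGen_of_sublist {η ω : List B} (h : η.Sublist ω) (hω : cs.IsReduced ω) :
    Relation.ReflTransGen cs.BruhatStep (cs.wordProd η) (cs.wordProd ω) := by
  have key : ∀ (i : B) (ω : List B), cs.IsReduced (i :: ω) → cs.IsReduced ω ∧
      cs.BruhatStep (cs.wordProd ω) (cs.simple i * cs.wordProd ω) := by
    intro i ω h
    have h1 : cs.IsReduced ω := by simpa using h.drop 1
    refine ⟨h1, (cs.wordProd ω)⁻¹ * cs.simple i * cs.wordProd ω, ⟨(cs.wordProd ω)⁻¹, i, by group⟩,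
      by group, ?_⟩
    have h2 := h.eq
    rw [wordProd_cons, List.length_cons] at h2
    have := h1.eq
    omega
  induction h with
  | slnil => exact .refl
  | @cons η ω i _ ih =>
    obtain ⟨h1, h2⟩ := key i ω hω
    rw [wordProd_cons]
    exact (ih h1).tail h2
  | @cons_cons η ω i _ ih =>
    obtain ⟨h1, h2⟩ := key i ω hω
    rw [wordProd_cons, wordProd_cons]
    rcases cs.reflTransGen_simple_mul i (ih h1) with h | h
    · exact h.tail h2
    · exact h

theorem bruhatLE_iff_reflTransGen {u v : W} :
    cs.BruhatLE u v ↔ Relation.ReflTransGen cs.BruhatStep u v := by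
  constructor
  · rintro ⟨ω, hω, rfl, η, hs, -, rfl⟩
    exact cs.reflTransGen_of_sublist hs hω
  · intro h
    obtain ⟨ω, hω, rfl⟩ := cs.exists_isReduced v
    obtain ⟨η, hs, rfl⟩ := cs.exists_sublist_of_reflTransGen h ω rfl
    obtain ⟨θ, hs', hr, hp⟩ := cs.exists_reduced_sublist η
    exact ⟨ω, hω, rfl, θ, hs'.trans hs, hr, hp⟩

theorem bruhatLE_refl (w : W) : cs.BruhatLE w w :=
  cs.bruhatLE_iff_reflTransGen.2 .refl

theorem BruhatLE.trans {u v w : W} (h : cs.BruhatLE u v) (h' : cs.BruhatLE v w) :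
    cs.BruhatLE u w :=
  cs.bruhatLE_iff_reflTransGen.2
    ((cs.bruhatLE_iff_reflTransGen.1 h).trans (cs.bruhatLE_iff_reflTransGen.1 h'))

theorem BruhatLE.antisymm {u v : W} (h : cs.BruhatLE u v) (h' : cs.BruhatLE v u) : u = v := by
  obtain ⟨ω, hω, rfl, η, hs, hη, rfl⟩ := h
  obtain ⟨ω', hω', e, η', hs', hη', e'⟩ := h'
  have h1 := hs'.length_le
  have h2 : ω'.length = η.length := by rw [← hω'.eq, e, hη.eq]
  have h3 : η'.length = ω.length := by rw [← hη'.eq, e', hω.eq]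
  rw [hs.eq_of_length_le (by omega)]

/-- The closed interval `[u, v]` in the Bruhat order, as a poset. -/
def BruhatInterval (u v : W) : Type _ := {x : W // cs.BruhatLE u x ∧ cs.BruhatLE x v}

instance (u v : W) : PartialOrder (cs.BruhatInterval u v) where
  le x y := cs.BruhatLE x.1 y.1
  le_refl x := cs.bruhatLE_refl x.1
  le_trans _ _ _ h h' := BruhatLE.trans cs h h'
  le_antisymm _ _ h h' := Subtype.ext (BruhatLE.antisymm cs h h')

end CoxeterSystem

/-! ### Flag vectors and the cd-index -/

namespace CDIndex

section Poset

variable (P : Type*) [PartialOrder P]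

/-- The rank of a finite graded poset: the largest rank of an element. (In a finite graded poset the
rank of `x` is `Order.height x`, the length of a longest chain descending from `x`.) -/
noncomputable def posetRank : ℕ := (⨆ x : P, Order.height x).toNat

/-- The flag f-vector: the number of chains `C` of `P` whose set of ranks is `S`. -/
noncomputable def flagF (S : Finset ℕ) : ℕ :=
  Nat.card {C : Set P // IsChain (· ≤ ·) C ∧
    (fun x : P => (Order.height x).toNat) '' C = (S : Set ℕ)}

/-- The flag h-vector. -/
noncomputable def flagH (S : Finset ℕ) : ℤ :=
  ∑ T ∈ S.powerset, (-1) ^ (S \ T).card * (flagF P T : ℤ)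

end Poset

/-- The noncommuting variables `a` and `b`. -/
inductive AB
  | a
  | b

/-- The noncommuting variables `c` and `d`. -/
inductive CD
  | c
  | d

/-- The monomial `u_S = u_1 u_2 ⋯ u_n`, where `u_i = b` if `i ∈ S` and `u_i = a` otherwise. -/
noncomputable def flagMonomial (n : ℕ) (S : Finset ℕ) : FreeAlgebra ℤ AB :=
  ((List.range n).map fun i =>
    if i + 1 ∈ S then FreeAlgebra.ι ℤ AB.b else FreeAlgebra.ι ℤ AB.a).prod

/-- The ab-index of a finite graded poset of rank `n + 1`. (For a one-element poset this reads `1`.)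
-/
noncomputable def abIndex (P : Type*) [PartialOrder P] : FreeAlgebra ℤ AB :=
  ∑ S ∈ (Finset.Icc 1 (posetRank P - 1)).powerset,
    flagH P S • flagMonomial (posetRank P - 1) S

/-- The substitution `c = a + b`, `d = ab + ba`. -/
noncomputable def substAB : FreeAlgebra ℤ CD →ₐ[ℤ] FreeAlgebra ℤ AB :=
  FreeAlgebra.lift ℤ fun
    | CD.c => FreeAlgebra.ι ℤ AB.a + FreeAlgebra.ι ℤ AB.b
    | CD.d => FreeAlgebra.ι ℤ AB.a * FreeAlgebra.ι ℤ AB.b +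
        FreeAlgebra.ι ℤ AB.b * FreeAlgebra.ι ℤ AB.a

/-- `P` has a (well-defined) cd-index: its ab-index can be written in exactly one way as a polynomial
in `c` and `d`. -/
def HasCDIndex (P : Type*) [PartialOrder P] : Prop :=
  ∃! Φ : FreeAlgebra ℤ CD, substAB Φ = abIndex P

open Classical in
/-- The cd-index `Φ_P` (and `0` if `P` has none). -/
noncomputable def cdIndex (P : Type*) [PartialOrder P] : FreeAlgebra ℤ CD :=
  if h : HasCDIndex P then h.choose else 0

/-- The coefficient of a cd-monomial in a cd-polynomial. -/
noncomputable def cdCoeff (Φ : FreeAlgebra ℤ CD) (m : FreeMonoid CD) : ℤ :=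
  (FreeAlgebra.equivMonoidAlgebraFreeMonoid Φ).coeff m

end CDIndex

/-- Nonnegativity of the cd-indices of all Bruhat intervals of a Coxeter group. -/
def CoxeterSystem.CDNonneg {B W : Type*} [Group W] {M : CoxeterMatrix B}
    (cs : CoxeterSystem M W) : Prop :=
  ∀ u v : W, cs.BruhatLE u v →
    ∀ m : FreeMonoid CDIndex.CD, 0 ≤ CDIndex.cdCoeff (CDIndex.cdIndex (cs.BruhatInterval u v)) m

/-! The comparison is an induction on length. If `i` is a left descent of `w` and `x = i * w ≠ 1`,
then `Φ[1,w] = pyr Φ[1,x] - ∑ Φ[1,v] * d * Φ[v,x]`, the sum running over the `v` in `(1,x)` that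
left multiplication by `i` moves down. Here `pyr Φ = Φ * c + Φ'`, and the derivation takes `c` to
`d` and `d` to `cd`. Under the hypothesis the sum is nonnegative, so `Φ[1,w] ≤ pyr Φ[1,x]`. For
Boolean algebras the analogous sum is empty and equality holds (`cdIndex_set_succ`). Since `pyr`
preserves nonnegativity, the inequality passes from length `n` to length `n + 1`.

Both recursions come from one formula for special matchings `s`, of which left multiplication on
`[1,w]` and toggling one element of a set are instances. Sorting chains by their top element gives
`ψ = e + ψ b e`, where `ψ` is the matrix of ab-indices and `e` has entries `(a - b) ^ (length - 1)`.
The matching enters through a relation that is linear in `e` (`powMatrix_conj`), because it shifts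
exponents by one; `conj_identity` transports this relation to `ψ` (`abMatrix_conj`). The derivation
with `a, b ↦ d` kills `e`, so it sends `ψ` to `ψ d ψ` (`derivAB_map_abMatrix`). Together these
express the ab-index of `[u, s x]` by cd-polynomials of intervals with top at most `x`
(`substAB_pyr_sub`, `substAB_sub_derivCD_add`). This also proves that cd-indices exist; uniqueness
is `substAB_injective`. -/

/-! ### Derivations of free algebras -/

namespace FreeAlgebra

variable {X : Type*}

/-- The algebra homomorphism `f ↦ f + ε D f`, where `D` is the derivation with prescribed values `g`
on the generators. -/
noncomputable def derivHom (g : X → FreeAlgebra ℤ X) :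
    FreeAlgebra ℤ X →ₐ[ℤ] TrivSqZeroExt (FreeAlgebra ℤ X) (FreeAlgebra ℤ X) :=
  lift ℤ fun x => TrivSqZeroExt.inl (ι ℤ x) + TrivSqZeroExt.inr (g x)

theorem fst_derivHom (g : X → FreeAlgebra ℤ X) (f : FreeAlgebra ℤ X) :
    (derivHom g f).fst = f := by
  induction f using FreeAlgebra.induction with
  | grade0 r => rw [AlgHom.commutes]; rfl
  | grade1 x => simp [derivHom]
  | mul p q hp hq => rw [map_mul, TrivSqZeroExt.fst_mul, hp, hq]
  | add p q hp hq => rw [map_add, TrivSqZeroExt.fst_add, hp, hq]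

/-- The derivation of a free algebra with prescribed values on the generators. -/
noncomputable def deriv (g : X → FreeAlgebra ℤ X) : FreeAlgebra ℤ X →+ FreeAlgebra ℤ X where
  toFun f := (derivHom g f).snd
  map_zero' := by simp
  map_add' := by simp

@[simp]
theorem deriv_ι (g : X → FreeAlgebra ℤ X) (x : X) : deriv g (ι ℤ x) = g x := by
  simp [deriv, derivHom]

@[simp]
theorem deriv_one (g : X → FreeAlgebra ℤ X) : deriv g 1 = 0 := by
  simp [deriv]

theorem deriv_mul (g : X → FreeAlgebra ℤ X) (p q : FreeAlgebra ℤ X) :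
    deriv g (p * q) = deriv g p * q + p * deriv g q := by
  simp only [deriv, AddMonoidHom.coe_mk, ZeroHom.coe_mk, map_mul, TrivSqZeroExt.snd_mul,
    fst_derivHom]
  rw [add_comm]
  rfl

@[simp]
theorem deriv_algebraMap (g : X → FreeAlgebra ℤ X) (r : ℤ) :
    deriv g (algebraMap ℤ (FreeAlgebra ℤ X) r) = 0 := by
  simp [deriv]

theorem deriv_pow_of_eq_zero (g : X → FreeAlgebra ℤ X) {p : FreeAlgebra ℤ X}
    (hp : deriv g p = 0) (n : ℕ) : deriv g (p ^ n) = 0 := by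
  induction n with
  | zero => simp
  | succ n ih => rw [pow_succ, deriv_mul, ih, hp, zero_mul, mul_zero, add_zero]

end FreeAlgebra

/-! ### The algebra of ab- and cd-polynomials -/

namespace CDIndex

open FreeAlgebra

/-- The polynomial `a` in the noncommuting variables `a`, `b`. -/
noncomputable abbrev varA : FreeAlgebra ℤ AB := ι ℤ AB.a

/-- The polynomial `b` in the noncommuting variables `a`, `b`. -/
noncomputable abbrev varB : FreeAlgebra ℤ AB := ι ℤ AB.b

/-- The polynomial `c` in the noncommuting variables `c`, `d`. -/
noncomputable abbrev varC : FreeAlgebra ℤ CD := ι ℤ CD.c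

/-- The polynomial `d` in the noncommuting variables `c`, `d`. -/
noncomputable abbrev varD : FreeAlgebra ℤ CD := ι ℤ CD.d

@[simp]
theorem substAB_varC : substAB varC = varA + varB := by simp [substAB]

@[simp]
theorem substAB_varD : substAB varD = varA * varB + varB * varA := by simp [substAB]

/-! ### Uniqueness of the cd-form. -/

/-- A representation of ab-polynomials by matrices of cd-polynomials in which `c` becomes upper
triangular and `d` becomes scalar. -/
noncomputable def triangularRep :
    FreeAlgebra ℤ AB →ₐ[ℤ] Matrix (Fin 2) (Fin 2) (FreeAlgebra ℤ CD) :=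
  lift ℤ fun
    | AB.a => !![varC, varD; -1, -varC]
    | AB.b => !![0, 0; 1, 0]

/-- The vanishing of the lower left entry is carried through the induction because it is what makes
the upper left entry multiplicative. That entry therefore recovers `Φ` from its substitution. -/
theorem triangularRep_substAB (Φ : FreeAlgebra ℤ CD) :
    triangularRep (substAB Φ) 1 0 = 0 ∧ triangularRep (substAB Φ) 0 0 = Φ := by
  induction Φ using FreeAlgebra.induction with
  | grade0 r =>
    simp only [AlgHom.commutes, Matrix.algebraMap_matrix_apply]
    simp
  | grade1 x => cases x <;> simp [triangularRep]
  | mul p q hp hq => simp [Matrix.mul_apply, Fin.sum_univ_two, hp, hq]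
  | add p q hp hq => simp [hp, hq]

theorem substAB_injective : Function.Injective substAB := fun p q h => by
  rw [← (triangularRep_substAB p).2, h, (triangularRep_substAB q).2]

theorem hasCDIndex_of_substAB_eq {P : Type*} [PartialOrder P] {Φ : FreeAlgebra ℤ CD}
    (h : substAB Φ = abIndex P) : HasCDIndex P :=
  ⟨Φ, h, fun _ h' => substAB_injective (h'.trans h.symm)⟩

theorem substAB_cdIndex {P : Type*} [PartialOrder P] (h : HasCDIndex P) :
    substAB (cdIndex P) = abIndex P := by
  rw [cdIndex, dif_pos h]
  exact h.choose_spec.1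

theorem cdIndex_eq_of_substAB_eq {P : Type*} [PartialOrder P] {Φ : FreeAlgebra ℤ CD}
    (h : substAB Φ = abIndex P) : cdIndex P = Φ :=
  substAB_injective ((substAB_cdIndex (hasCDIndex_of_substAB_eq h)).trans h.symm)

/-! ### Compatible derivations of ab- and cd-polynomials. -/

/-- The derivation of ab-polynomials that takes `a` and `b` to `d = ab + ba`. -/
noncomputable def derivAB : FreeAlgebra ℤ AB →+ FreeAlgebra ℤ AB :=
  deriv fun _ => varA * varB + varB * varA

/-- The derivation of cd-polynomials that takes `c` to `d` and `d` to `cd`. -/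
noncomputable def derivCD : FreeAlgebra ℤ CD →+ FreeAlgebra ℤ CD :=
  deriv fun
    | CD.c => varD
    | CD.d => varC * varD

theorem derivAB_mul (p q : FreeAlgebra ℤ AB) :
    derivAB (p * q) = derivAB p * q + p * derivAB q := deriv_mul _ p q

theorem derivCD_mul (p q : FreeAlgebra ℤ CD) :
    derivCD (p * q) = derivCD p * q + p * derivCD q := deriv_mul _ p q

theorem derivAB_varB : derivAB varB = varA * varB + varB * varA := deriv_ι _ _

/-- This is the reason for giving `a` and `b` the same image: the powers of `a - b` in the chain
recursion become constants. -/
theorem derivAB_sub_pow (n : ℕ) : derivAB ((varA - varB) ^ n) = 0 :=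
  deriv_pow_of_eq_zero _ (by rw [map_sub, deriv_ι, deriv_ι, sub_self]) n

/-- Both sides are derivations along the substitution, so the generators decide: `c` gives `2d`, and
`d` gives `(cd - dc) + (dc + cd) = 2cd`. -/
theorem two_mul_substAB_derivCD (Φ : FreeAlgebra ℤ CD) :
    2 * substAB (derivCD Φ) = (varA + varB) * substAB Φ - substAB Φ * (varA + varB) +
      derivAB (substAB Φ) := by
  induction Φ using FreeAlgebra.induction with
  | grade0 r =>
    rw [derivCD, derivAB, deriv_algebraMap, AlgHom.commutes, deriv_algebraMap,
      Algebra.commutes r (varA + varB)]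
    simp
  | grade1 x =>
    cases x with
    | c =>
      simp only [derivCD, derivAB, deriv_ι, substAB_varC, substAB_varD, map_add]
      noncomm_ring
    | d =>
      simp only [derivCD, derivAB, deriv_ι, substAB_varC, substAB_varD, map_add, map_mul,
        deriv_mul]
      noncomm_ring
  | mul p q hp hq =>
    rw [derivCD_mul, map_add, map_mul, map_mul, map_mul, derivAB_mul, mul_add, ← mul_assoc, hp,
      ← mul_assoc, (Commute.ofNat_left 2 (substAB p)).eq, mul_assoc (substAB p) 2, hq]
    noncomm_ring
  | add p q hp hq =>
    simp only [map_add, mul_add, hp, hq]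
    noncomm_ring

/-- The effect of taking pyramids on the cd-index. -/
noncomputable def pyr : FreeAlgebra ℤ CD →+ FreeAlgebra ℤ CD :=
  AddMonoidHom.mulRight varC + derivCD

theorem pyr_apply (Φ : FreeAlgebra ℤ CD) : pyr Φ = Φ * varC + derivCD Φ := rfl

/-! ### cd-polynomials with nonnegative coefficients -/

theorem cdCoeff_add (p q : FreeAlgebra ℤ CD) (m : FreeMonoid CD) :
    cdCoeff (p + q) m = cdCoeff p m + cdCoeff q m := by
  simp [cdCoeff]

theorem cdCoeff_sub (p q : FreeAlgebra ℤ CD) (m : FreeMonoid CD) :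
    cdCoeff (p - q) m = cdCoeff p m - cdCoeff q m := by
  simp [cdCoeff]

/-- The cd-polynomials with nonnegative coefficients. -/
noncomputable def nonnegCD : Subsemiring (FreeAlgebra ℤ CD) := Subsemiring.closure {varC, varD}

theorem varC_mem_nonnegCD : varC ∈ nonnegCD := Subsemiring.subset_closure (by simp)

theorem varD_mem_nonnegCD : varD ∈ nonnegCD := Subsemiring.subset_closure (by simp)

/-- Hypothesis and conclusion of the theorem are coefficientwise, while stability under products and
derivations is easiest by closure induction; this passes between the two. -/
theorem mem_nonnegCD_iff {Φ : FreeAlgebra ℤ CD} :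
    Φ ∈ nonnegCD ↔ ∀ m : FreeMonoid CD, 0 ≤ cdCoeff Φ m := by
  classical
  constructor
  · intro h
    induction h using Subsemiring.closure_induction with
    | mem x hx =>
      intro m
      have hs : ∀ y : CD, 0 ≤ cdCoeff (ι ℤ y) m := by
        intro y
        simp only [cdCoeff, equivMonoidAlgebraFreeMonoid, AlgEquiv.ofAlgHom_apply, lift_ι_apply,
          MonoidAlgebra.of_apply, MonoidAlgebra.coeff_single, Finsupp.single_apply]
        split_ifs <;> simp
      rcases hx with rfl | rfl <;> exact hs _
    | zero => intro m; simp [cdCoeff]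
    | one =>
      intro m
      simp only [cdCoeff, map_one, MonoidAlgebra.one_def, MonoidAlgebra.coeff_single,
        Finsupp.single_apply]
      split_ifs <;> simp
    | add p q _ _ hp hq => intro m; rw [cdCoeff_add]; exact add_nonneg (hp m) (hq m)
    | mul p q _ _ hp hq =>
      intro m
      unfold cdCoeff at hp hq ⊢
      rw [map_mul, MonoidAlgebra.coeff_mul]
      refine Finset.sum_nonneg fun i _ => Finset.sum_nonneg fun j _ => ?_
      dsimp only
      split_ifs
      exacts [mul_nonneg (hp i) (hq j), le_rfl]
  · intro h
    have hw : ∀ w : FreeMonoid CD, FreeMonoid.lift (ι ℤ) w ∈ nonnegCD := by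
      intro w
      induction w using FreeMonoid.inductionOn' with
      | one => rw [map_one]; exact one_mem _
      | of_mul x w ih =>
        rw [map_mul, FreeMonoid.lift_eval_of]
        refine mul_mem ?_ ih
        cases x
        exacts [varC_mem_nonnegCD, varD_mem_nonnegCD]
    rw [← equivMonoidAlgebraFreeMonoid.symm_apply_apply Φ]
    simp only [equivMonoidAlgebraFreeMonoid, AlgEquiv.ofAlgHom_symm_apply]
    rw [MonoidAlgebra.lift_apply]
    refine sum_mem fun m _ => ?_
    obtain ⟨k, hk⟩ := Int.eq_ofNat_of_zero_le (show 0 ≤ cdCoeff Φ m from h m)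
    change cdCoeff Φ m • FreeMonoid.lift (ι ℤ) m ∈ nonnegCD
    rw [hk, natCast_zsmul]
    exact nsmul_mem (hw m) k

theorem derivCD_mem_nonnegCD {Φ : FreeAlgebra ℤ CD} (h : Φ ∈ nonnegCD) :
    derivCD Φ ∈ nonnegCD := by
  induction h using Subsemiring.closure_induction with
  | mem x hx =>
    rcases hx with rfl | rfl
    · rw [derivCD, deriv_ι]; exact varD_mem_nonnegCD
    · rw [derivCD, deriv_ι]; exact mul_mem varC_mem_nonnegCD varD_mem_nonnegCD
  | zero => rw [map_zero]; exact zero_mem _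
  | one => rw [derivCD, deriv_one]; exact zero_mem _
  | add p q _ _ hp hq => rw [map_add]; exact add_mem hp hq
  | mul p q hp' hq' hp hq => rw [derivCD_mul]; exact add_mem (mul_mem hp hq') (mul_mem hp' hq)

theorem pyr_mem_nonnegCD {Φ : FreeAlgebra ℤ CD} (h : Φ ∈ nonnegCD) : pyr Φ ∈ nonnegCD :=
  add_mem (mul_mem h varC_mem_nonnegCD) (derivCD_mem_nonnegCD h)

theorem cdCoeff_le_iff {p q : FreeAlgebra ℤ CD} :
    (∀ m : FreeMonoid CD, cdCoeff p m ≤ cdCoeff q m) ↔ q - p ∈ nonnegCD := by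
  simp only [mem_nonnegCD_iff, cdCoeff_sub, sub_nonneg]

end CDIndex

/-! ### Ranked posets -/

namespace CDIndex

/-- `ρ` is the rank function of the poset `I`, up to an additive constant on every interval. -/
structure IsRankFunction {I : Type*} [PartialOrder I] (ρ : I → ℕ) : Prop where
  strictMono : StrictMono ρ
  exists_pred : ∀ u v, u < v → ∃ w, u ≤ w ∧ w < v ∧ ρ w + 1 = ρ v

section Rank

variable {I : Type*} [PartialOrder I] {ρ : I → ℕ}

/-- Strict monotonicity bounds the height from above; `exists_pred` descends one rank at a time
without leaving the interval, which bounds it from below. -/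
theorem IsRankFunction.height_Icc (h : IsRankFunction ρ) {u v : I} (x : Set.Icc u v) :
    Order.height x = ((ρ x - ρ u : ℕ) : ℕ∞) := by
  obtain ⟨k, hk⟩ : ∃ k, ρ x = ρ u + k := ⟨ρ x - ρ u, by have := h.strictMono.monotone x.2.1; omega⟩
  rw [hk, Nat.add_sub_cancel_left]
  induction k using Nat.strong_induction_on generalizing x with
  | _ k ih =>
    apply le_antisymm
    · rw [Order.height_le_coe_iff]
      intro y hy
      have h1 : ρ y < ρ x := h.strictMono hy
      have h2 : ρ u ≤ ρ y := h.strictMono.monotone y.2.1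
      rw [ih (ρ y - ρ u) (by omega) y (by omega)]
      exact_mod_cast (by omega : ρ y - ρ u < k)
    · rcases eq_or_lt_of_le x.2.1 with hux | hux
      · have : k = 0 := by rw [← hux] at hk; omega
        simp [this]
      · obtain ⟨w, huw, hwx, hw⟩ := h.exists_pred u x hux
        have h2 : ρ u ≤ ρ w := h.strictMono.monotone huw
        have h3 := ih (k - 1) (by omega) ⟨w, huw, hwx.le.trans x.2.2⟩ (by dsimp only; omega)
        have h4 := Order.height_add_one_le
          (show (⟨w, huw, hwx.le.trans x.2.2⟩ : Set.Icc u v) < x from hwx)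
        rw [h3] at h4
        refine le_trans ?_ h4
        exact_mod_cast (by omega : k ≤ k - 1 + 1)

theorem IsRankFunction.posetRank_Icc (h : IsRankFunction ρ) {u v : I} (huv : u ≤ v) :
    posetRank (Set.Icc u v) = ρ v - ρ u := by
  have : (⨆ x : Set.Icc u v, Order.height x) = ((ρ v - ρ u : ℕ) : ℕ∞) := by
    apply le_antisymm
    · refine iSup_le fun x => ?_
      rw [h.height_Icc]
      have := h.strictMono.monotone x.2.2
      exact_mod_cast (by omega : ρ x - ρ u ≤ ρ v - ρ u)
    · rw [← h.height_Icc (⟨v, huv, le_rfl⟩ : Set.Icc u v)]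
      exact le_iSup (fun x : Set.Icc u v => Order.height x) _
  rw [posetRank, this, ENat.toNat_natCast]

/-- The chains of the interval `[u, v]` with rank set `T`, as sets of elements of the ambient
poset. -/
def chainsIcc (ρ : I → ℕ) (u v : I) (T : Finset ℕ) : Set (Set I) :=
  {C | IsChain (· ≤ ·) C ∧ C ⊆ Set.Icc u v ∧ (fun x => ρ x - ρ u) '' C = (T : Set ℕ)}

theorem IsRankFunction.flagF_Icc (h : IsRankFunction ρ) (u v : I) (T : Finset ℕ) :
    flagF (Set.Icc u v) T = Nat.card (chainsIcc ρ u v T) := by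
  refine Nat.card_congr (Equiv.ofBijective
    (fun C => ⟨Subtype.val '' C.1, ?_, ?_, ?_⟩) ⟨?_, ?_⟩)
  · rintro _ ⟨x, hx, rfl⟩ _ ⟨y, hy, rfl⟩ hxy
    exact C.2.1 hx hy (fun e => hxy (congrArg _ e))
  · rintro _ ⟨x, -, rfl⟩
    exact x.2
  · refine Eq.trans ?_ C.2.2
    rw [Set.image_image]
    simp only [h.height_Icc, ENat.toNat_natCast]
  · intro C C' hC
    exact Subtype.ext (Set.image_injective.2 Subtype.val_injective (congrArg Subtype.val hC))
  · rintro ⟨C, hC1, hC2, hC3⟩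
    refine ⟨⟨Subtype.val ⁻¹' C, ?_, ?_⟩, ?_⟩
    · intro x hx y hy hxy
      exact hC1 hx hy (fun e => hxy (Subtype.ext e))
    · simp only [h.height_Icc, ENat.toNat_natCast]
      rw [← hC3, ← Set.image_image (fun x => ρ x - ρ u) Subtype.val, Subtype.image_preimage_coe,
        Set.inter_eq_right.2 hC2]
    · apply Subtype.ext
      dsimp only
      rw [Subtype.image_preimage_coe, Set.inter_eq_right.2 hC2]

theorem card_chainsIcc_empty (u v : I) : Nat.card (chainsIcc ρ u v ∅) = 1 := by
  have : chainsIcc ρ u v ∅ = {∅} := by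
    ext C
    simp only [chainsIcc, Finset.coe_empty, Set.image_eq_empty, Set.mem_ofPred_eq,
      Set.mem_singleton_iff]
    constructor
    · exact fun h => h.2.2
    · rintro rfl
      exact ⟨Set.pairwise_empty _, Set.empty_subset _, rfl⟩
  rw [this]
  simp

-- As `m` exceeds every rank in `T`, the element of rank `m` is the top `y` of the chain, and
-- removing it leaves a chain of `[u, y]` with rank set `T`. The bounds on `m` make `u < y < v`
-- strict.
open Classical in
theorem card_chainsIcc_insert [Fintype I] (h : StrictMono ρ) {u v : I} {m : ℕ} {T : Finset ℕ}
    (hT : ∀ k ∈ T, k < m) (hm : 1 ≤ m) (hmv : ρ u + m < ρ v) :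
    Nat.card (chainsIcc ρ u v (insert m T)) =
      ∑ y with u < y ∧ y < v ∧ ρ y = ρ u + m, Nat.card (chainsIcc ρ u y T) := by
  have hrank : ∀ {y : I} {C : Set I}, C ∈ chainsIcc ρ u y T → ∀ x ∈ C, ρ x - ρ u < m :=
    fun hC x hx => hT _ (by
      have : ρ x - ρ u ∈ (T : Set ℕ) := hC.2.2 ▸ Set.mem_image_of_mem _ hx
      exact this)
  have key : (Σ y : {y : I // u < y ∧ y < v ∧ ρ y = ρ u + m}, chainsIcc ρ u y.1 T) ≃
      chainsIcc ρ u v (insert m T) := by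
    refine Equiv.ofBijective (fun p => ⟨insert p.1.1 p.2.1, ?_, ?_, ?_⟩) ⟨?_, ?_⟩
    · refine p.2.2.1.insert fun x hx _ => Or.inr (p.2.2.2.1 hx).2
    · rintro x (rfl | hx)
      · exact ⟨p.1.2.1.le, p.1.2.2.1.le⟩
      · exact ⟨(p.2.2.2.1 hx).1, (p.2.2.2.1 hx).2.trans p.1.2.2.1.le⟩
    · rw [Set.image_insert_eq, p.2.2.2.2, p.1.2.2.2, Nat.add_sub_cancel_left, Finset.coe_insert]
    · rintro ⟨⟨y, hy⟩, ⟨C, hC⟩⟩ ⟨⟨z, hz⟩, ⟨C', hC'⟩⟩ he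
      have he : insert y C = insert z C' := congrArg Subtype.val he
      have hyC : y ∉ C := fun hm' => by have := hrank hC y hm'; omega
      have hzC : z ∉ C' := fun hm' => by have := hrank hC' z hm'; omega
      have hyC' : y ∉ C' := fun hm' => by have := hrank hC' y hm'; omega
      have hyz : y = z := by
        have : y ∈ insert z C' := he ▸ Set.mem_insert y C
        exact this.resolve_right hyC'
      subst hyz
      have hCC : C = C' := by
        rw [← Set.insert_sdiff_self_of_notMem hyC, he, Set.insert_sdiff_self_of_notMem hzC]
      subst hCC
      rfl
    · rintro ⟨C, hC1, hC2, hC3⟩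
      have hmem : m ∈ (fun x => ρ x - ρ u) '' C := by rw [hC3]; simp
      obtain ⟨y, hyC, hy⟩ := hmem
      dsimp only at hy
      have hle : ∀ x ∈ C, ρ u ≤ ρ x := fun x hx => h.monotone (hC2 hx).1
      have hyu := hle y hyC
      have hxm : ∀ x ∈ C, x ≠ y → ρ x - ρ u ∈ T := by
        intro x hx hxy
        have h1 : ρ x - ρ u ∈ ((insert m T : Finset ℕ) : Set ℕ) :=
          hC3 ▸ Set.mem_image_of_mem _ hx
        have h2 : ρ x - ρ u ≠ m := by
          have := hle x hx
          rcases hC1 hx hyC hxy with h' | h'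
          · have := h (lt_of_le_of_ne h' hxy); omega
          · have := h (lt_of_le_of_ne h' hxy.symm); omega
        simpa [h2] using h1
      refine ⟨⟨⟨y, ?_, ?_, by omega⟩, ⟨C \ {y}, hC1.mono Set.sdiff_subset, ?_, ?_⟩⟩, ?_⟩
      · exact lt_of_le_of_ne (hC2 hyC).1 (by rintro rfl; omega)
      · exact lt_of_le_of_ne (hC2 hyC).2 (by rintro rfl; omega)
      · rintro x ⟨hx, hxy⟩
        refine ⟨(hC2 hx).1, (hC1 hx hyC hxy).resolve_right fun h' => ?_⟩
        have h1 := h (lt_of_le_of_ne h' (Ne.symm hxy))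
        have h2 := hT _ (hxm x hx hxy)
        omega
      · ext k
        constructor
        · rintro ⟨x, ⟨hx, hxy⟩, rfl⟩
          exact hxm x hx hxy
        · intro hk
          have h1 : k ∈ (fun x => ρ x - ρ u) '' C := by
            rw [hC3]; exact Finset.mem_insert_of_mem hk
          obtain ⟨x, hx, hxk⟩ := h1
          dsimp only at hxk
          refine ⟨x, ⟨hx, ?_⟩, hxk⟩
          rintro rfl
          have := hT k hk
          omega
      · apply Subtype.ext
        dsimp only
        rw [Set.insert_sdiff_singleton, Set.insert_eq_of_mem hyC]
  rw [← Nat.card_congr key, Nat.card_sigma]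
  exact (Finset.sum_subtype _ (by simp) fun y => Nat.card (chainsIcc ρ u y T)).symm

end Rank

/-! ### Recursion for the ab-index -/

/-- The ab-polynomial attached to a flag f-vector `F` on the subsets of `{1, …, n}`. -/
noncomputable def abTransform (n : ℕ) (F : Finset ℕ → ℤ) : FreeAlgebra ℤ AB :=
  ∑ S ∈ (Finset.Icc 1 n).powerset,
    (∑ T ∈ S.powerset, (-1) ^ (S \ T).card * F T) • flagMonomial n S

theorem abTransform_congr {n : ℕ} {F G : Finset ℕ → ℤ} (h : ∀ T ⊆ Finset.Icc 1 n, F T = G T) :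
    abTransform n F = abTransform n G := by
  refine Finset.sum_congr rfl fun S hS => ?_
  congr 1
  refine Finset.sum_congr rfl fun T hT => ?_
  rw [h T ((Finset.mem_powerset.1 hT).trans (Finset.mem_powerset.1 hS))]

theorem abTransform_sum {ι : Type*} (n : ℕ) (s : Finset ι) (F : ι → Finset ℕ → ℤ) :
    abTransform n (fun T => ∑ i ∈ s, F i T) = ∑ i ∈ s, abTransform n (F i) := by
  unfold abTransform
  rw [Finset.sum_comm]
  refine Finset.sum_congr rfl fun S _ => ?_
  rw [← Finset.sum_smul, Finset.sum_comm]
  simp only [Finset.mul_sum]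

theorem abTransform_zero (F : Finset ℕ → ℤ) : abTransform 0 F = F ∅ • 1 := by
  simp [abTransform, flagMonomial]

theorem flagMonomial_succ (n : ℕ) (S : Finset ℕ) :
    flagMonomial (n + 1) S = flagMonomial n S * if n + 1 ∈ S then varB else varA := by
  simp [flagMonomial, List.range_succ]

theorem flagMonomial_insert (n : ℕ) (S : Finset ℕ) :
    flagMonomial n (insert (n + 1) S) = flagMonomial n S := by
  unfold flagMonomial
  congr 1
  refine List.map_congr_left fun i hi => ?_
  have : i ≠ n := (List.mem_range.1 hi).ne
  simp [this]

/-- Pair `S` with `insert (n + 1) S`. Subsets `T` avoiding `n + 1` contribute to both with opposite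
signs, whence the last factor `a - b`; subsets containing `n + 1` contribute only to the second,
whence `b`. -/
theorem abTransform_succ (n : ℕ) (F : Finset ℕ → ℤ) :
    abTransform (n + 1) F = abTransform n F * (varA - varB) +
      abTransform n (fun T => F (insert (n + 1) T)) * varB := by
  have hI : Finset.Icc 1 (n + 1) = insert (n + 1) (Finset.Icc 1 n) := by
    ext k; simp only [Finset.mem_Icc, Finset.mem_insert]; omega
  have hn : n + 1 ∉ Finset.Icc 1 n := by simp
  unfold abTransform
  rw [hI, Finset.sum_powerset_insert hn, Finset.sum_mul, Finset.sum_mul,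
    ← Finset.sum_add_distrib, ← Finset.sum_add_distrib]
  refine Finset.sum_congr rfl fun S hS => ?_
  have hnS : n + 1 ∉ S := fun h => hn (Finset.mem_powerset.1 hS h)
  rw [flagMonomial_succ, flagMonomial_succ, flagMonomial_insert, if_neg hnS,
    if_pos (Finset.mem_insert_self _ _), Finset.sum_powerset_insert hnS]
  have h1 : ∑ T ∈ S.powerset, (-1 : ℤ) ^ (insert (n + 1) S \ T).card * F T =
      - ∑ T ∈ S.powerset, (-1 : ℤ) ^ (S \ T).card * F T := by
    rw [← Finset.sum_neg_distrib]
    refine Finset.sum_congr rfl fun T hT => ?_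
    have hnT : n + 1 ∉ T := fun h => hnS (Finset.mem_powerset.1 hT h)
    rw [Finset.insert_sdiff_of_notMem _ hnT, Finset.card_insert_of_notMem (by simp [hnS]), pow_succ]
    ring
  have h2 : ∑ T ∈ S.powerset,
        (-1 : ℤ) ^ (insert (n + 1) S \ insert (n + 1) T).card * F (insert (n + 1) T) =
      ∑ T ∈ S.powerset, (-1 : ℤ) ^ (S \ T).card * F (insert (n + 1) T) := by
    refine Finset.sum_congr rfl fun T hT => ?_
    rw [Finset.insert_sdiff_insert, Finset.sdiff_insert_of_notMem hnS]
  rw [h1, h2, add_smul, neg_smul, mul_sub]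
  simp only [smul_mul_assoc]
  noncomm_ring

/-- The terms are sorted by the largest rank `m + 1`; each rank above it contributes one factor `a -
b`. -/
theorem abTransform_eq_sum (n : ℕ) (F : Finset ℕ → ℤ) :
    abTransform n F = F ∅ • (varA - varB) ^ n + ∑ m ∈ Finset.range n,
      abTransform m (fun T => F (insert (m + 1) T)) * varB * (varA - varB) ^ (n - 1 - m) := by
  induction n with
  | zero => simp [abTransform_zero]
  | succ n ih =>
    rw [abTransform_succ, ih, Finset.sum_range_succ, add_mul, smul_mul_assoc, ← pow_succ,
      Finset.sum_mul, add_assoc]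
    congr 2
    · refine Finset.sum_congr rfl fun m hm => ?_
      have := Finset.mem_range.1 hm
      rw [mul_assoc _ ((varA - varB) ^ _), ← pow_succ]
      congr 2
      omega
    · simp

section Recursion

variable {I : Type*} [PartialOrder I] {ρ : I → ℕ}

theorem IsRankFunction.abIndex_Icc (h : IsRankFunction ρ) {u v : I} (huv : u ≤ v) :
    abIndex (Set.Icc u v) =
      abTransform (ρ v - ρ u - 1) (fun T => (Nat.card (chainsIcc ρ u v T) : ℤ)) := by
  simp only [abIndex, flagH, abTransform, h.flagF_Icc, h.posetRank_Icc huv]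

theorem IsRankFunction.abIndex_Icc_self (h : IsRankFunction ρ) (u : I) :
    abIndex (Set.Icc u u) = 1 := by
  rw [h.abIndex_Icc le_rfl, Nat.sub_self, abTransform_zero, card_chainsIcc_empty]
  simp

open Classical in
theorem IsRankFunction.abIndex_Icc_eq_sum [Fintype I] (h : IsRankFunction ρ) {u v : I}
    (huv : u < v) :
    abIndex (Set.Icc u v) = (varA - varB) ^ (ρ v - ρ u - 1) +
      ∑ y with u < y ∧ y < v,
        abIndex (Set.Icc u y) * varB * (varA - varB) ^ (ρ v - ρ y - 1) := by
  rw [h.abIndex_Icc huv.le, abTransform_eq_sum, card_chainsIcc_empty, Nat.cast_one, one_smul]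
  congr 1
  have hlt := h.strictMono huv
  -- The top rank of a chain is `m + 1` in the preceding formula, so `y` belongs to the fibre of `ρ
  -- y - ρ u - 1`.
  rw [← Finset.sum_fiberwise_of_maps_to (s := Finset.univ.filter fun y => u < y ∧ y < v)
    (t := Finset.range (ρ v - ρ u - 1)) (g := fun y => ρ y - ρ u - 1)]
  · refine Finset.sum_congr rfl fun m hm => ?_
    have hm := Finset.mem_range.1 hm
    have h1 : abTransform m (fun T => (Nat.card (chainsIcc ρ u v (insert (m + 1) T)) : ℤ)) =
        ∑ y with u < y ∧ y < v ∧ ρ y = ρ u + (m + 1), abIndex (Set.Icc u y) := by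
      rw [abTransform_congr (G := fun T => ∑ y with u < y ∧ y < v ∧ ρ y = ρ u + (m + 1),
        (Nat.card (chainsIcc ρ u y T) : ℤ)), abTransform_sum]
      · refine Finset.sum_congr rfl fun y hy => ?_
        obtain ⟨hy1, hy2, hy3⟩ := (Finset.mem_filter.1 hy).2
        rw [h.abIndex_Icc hy1.le]
        congr 1
        omega
      · intro T hT
        rw [card_chainsIcc_insert h.strictMono _ (by omega) (by omega)]
        · push_cast; rfl
        · intro k hk
          have := (Finset.mem_Icc.1 (hT hk)).2
          omega
    rw [h1, Finset.sum_mul, Finset.sum_mul, Finset.filter_filter]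
    refine Finset.sum_congr ?_ fun y hy => ?_
    · ext y
      simp only [Finset.mem_filter, Finset.mem_univ, true_and]
      constructor
      · rintro ⟨hy1, hy2, hy3⟩
        exact ⟨⟨hy1, hy2⟩, by omega⟩
      · rintro ⟨⟨hy1, hy2⟩, hy3⟩
        have := h.strictMono hy1
        exact ⟨hy1, hy2, by omega⟩
    · congr 2
      obtain ⟨⟨hy1, hy2⟩, hy3⟩ := (Finset.mem_filter.1 hy).2
      have := h.strictMono hy1
      omega
  · intro y hy
    obtain ⟨hy1, hy2⟩ := (Finset.mem_filter.1 hy).2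
    have := h.strictMono hy1
    have := h.strictMono hy2
    simp only [Finset.mem_range]
    omega

end Recursion

/-! ### Invariance under isomorphism -/

section Iso

variable {P Q : Type*} [PartialOrder P] [PartialOrder Q]

theorem posetRank_congr (f : P ≃o Q) : posetRank P = posetRank Q := by
  unfold posetRank
  rw [← f.toEquiv.iSup_congr (fun x => Order.height_orderIso f x)]

theorem flagF_congr (f : P ≃o Q) (S : Finset ℕ) : flagF P S = flagF Q S := by
  refine Nat.card_congr ((Equiv.Set.congr f.toEquiv).subtypeEquiv fun C => ?_)
  have h1 : IsChain (· ≤ ·) (f '' C) ↔ IsChain (· ≤ ·) C := by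
    constructor
    · intro h x hx y hy hxy
      simpa using h (Set.mem_image_of_mem f hx) (Set.mem_image_of_mem f hy) (f.injective.ne hxy)
    · rintro h _ ⟨x, hx, rfl⟩ _ ⟨y, hy, rfl⟩ hxy
      simpa using h hx hy (fun e => hxy (congrArg f e))
  change _ ↔ IsChain (· ≤ ·) (f '' C) ∧ _ '' (f '' C) = _
  rw [h1, Set.image_image]
  simp only [Order.height_orderIso]

theorem abIndex_congr (f : P ≃o Q) : abIndex P = abIndex Q := by
  simp only [abIndex, flagH, posetRank_congr f, flagF_congr f]

theorem hasCDIndex_congr (f : P ≃o Q) : HasCDIndex P ↔ HasCDIndex Q := by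
  simp only [HasCDIndex, abIndex_congr f]

theorem cdIndex_congr (f : P ≃o Q) : cdIndex P = cdIndex Q := by
  have h : HasCDIndex P = HasCDIndex Q := propext (hasCDIndex_congr f)
  by_cases hP : HasCDIndex P
  · exact (cdIndex_eq_of_substAB_eq
      ((substAB_cdIndex hP).trans (abIndex_congr f))).symm
  · rw [cdIndex, cdIndex, dif_neg hP, dif_neg (h ▸ hP)]

end Iso

end CDIndex

/-! ### Special matchings -/

namespace CDIndex

/-- A ring identity for solutions `ψ` of the recursion `ψ = e + e b ψ`. -/
theorem conj_identity {R : Type*} [Ring R] {e ψ b t E N : R} (h1 : ψ = e + e * b * ψ)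
    (h2 : ψ = e + ψ * b * e) (hEb : E * b = b * E) (hEt : E * t = t * E) (hNb : N * b = b * N)
    (ht : t * E * e + e * E * t = 2 * (N * e - e * N) - 2 * E)
    (hu1 : IsUnit (1 - e * b)) (hu2 : IsUnit (1 - b * e)) :
    (t + 2 * b) * E * ψ + ψ * E * (t + 2 * b) + ψ * (b * t + t * b + 2 * (b * b)) * E * ψ =
      2 * (N * ψ - ψ * N) - 2 * E := by
  have h1' : (1 - e * b) * ψ = e := by
    rw [sub_mul, one_mul, sub_eq_iff_eq_add]; exact h1
  have h2' : ψ * (1 - b * e) = e := by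
    rw [mul_sub, mul_one, sub_eq_iff_eq_add, ← mul_assoc]; exact h2
  rw [← sub_eq_zero]
  -- Multiplying by `1 - e b` on the left and `1 - b e` on the right turns each outer `ψ` into `e`;
  -- what remains is `ht` plus commutations.
  refine hu1.mul_left_cancel (hu2.mul_right_cancel ?_)
  rw [mul_zero, zero_mul]
  have hexp : (1 - e * b) * ((t + 2 * b) * E * ψ + ψ * E * (t + 2 * b) +
      ψ * (b * t + t * b + 2 * (b * b)) * E * ψ - (2 * (N * ψ - ψ * N) - 2 * E)) * (1 - b * e) =
      (1 - e * b) * (t + 2 * b) * E * (ψ * (1 - b * e)) +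
      ((1 - e * b) * ψ) * E * (t + 2 * b) * (1 - b * e) +
      ((1 - e * b) * ψ) * (b * t + t * b + 2 * (b * b)) * E * (ψ * (1 - b * e)) -
      2 * ((1 - e * b) * N * (ψ * (1 - b * e))) + 2 * (((1 - e * b) * ψ) * N * (1 - b * e)) +
      2 * ((1 - e * b) * E * (1 - b * e)) := by
    noncomm_ring
  rw [hexp, h1', h2']
  linear_combination (norm := noncomm_ring) ht - 2 * (hEb * e) + 2 * (e * hEb) -
    e * t * hEb * e - e * hEt * b * e - 2 * (e * hEb * b * e) - 2 * (e * hNb * e)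

/-- Nonzero entries raise the rank by at least one, so nonzero entries of the `k`-th power raise it
by at least `k`. -/
theorem isNilpotent_of_strictlyTriangular {I R : Type*} [Fintype I] [DecidableEq I] [Ring R]
    (ρ : I → ℕ) {M : Matrix I I R} (hM : ∀ u x, ρ x ≤ ρ u → M u x = 0) : IsNilpotent M := by
  have h : ∀ k u x, ρ x < ρ u + k → (M ^ k) u x = 0 := by
    intro k
    induction k with
    | zero =>
      intro u x hux
      rw [pow_zero, Matrix.one_apply_ne]
      rintro rfl
      omega
    | succ k ih =>
      intro u x hux
      rw [pow_succ, Matrix.mul_apply]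
      refine Finset.sum_eq_zero fun y _ => ?_
      rcases lt_or_ge (ρ y) (ρ u + k) with h | h
      · rw [ih u y h, zero_mul]
      · rw [hM y x (by omega), mul_zero]
  -- A crude exponent exceeding every rank.
  refine ⟨∑ x, ρ x + 1, ?_⟩
  ext u x
  refine h _ u x ?_
  have := Finset.single_le_sum (f := ρ) (fun _ _ => Nat.zero_le _) (Finset.mem_univ x)
  omega

/-- A special matching of a poset with rank function `ρ`: an involution `s` that changes ranks by
one and is compatible with the order. -/
structure IsSpecialMatching {I : Type*} [PartialOrder I] (ρ : I → ℕ) (s : I → I) : Prop where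
  apply_apply : ∀ x, s (s x) = x
  rank_apply : ∀ x, ρ (s x) = ρ x + 1 ∨ ρ (s x) + 1 = ρ x
  le_apply : ∀ x, ρ x < ρ (s x) → x ≤ s x
  le_of_le_apply : ∀ x y, ρ x < ρ (s x) → ρ y < ρ (s y) → x ≤ s y → x ≤ y
  apply_le_apply : ∀ x y, ρ x < ρ (s x) → ρ y < ρ (s y) → x ≤ y → s x ≤ s y

open Classical in
/-- The matrix of the polynomials `(a - b) ^ (ℓ - 1)`, where `ℓ` is the length of an interval. -/
noncomputable def powMatrix {I : Type*} [PartialOrder I] (ρ : I → ℕ) :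
    Matrix I I (FreeAlgebra ℤ AB) :=
  Matrix.of fun u x => if u < x then (varA - varB) ^ (ρ x - ρ u - 1) else 0

open Classical in
/-- The matrix of the ab-indices of the nontrivial intervals of a poset. -/
noncomputable def abMatrix (I : Type*) [PartialOrder I] : Matrix I I (FreeAlgebra ℤ AB) :=
  Matrix.of fun u x => if u < x then abIndex (Set.Icc u x) else 0

/-- The diagonal matrix of the signs that tell whether `s` goes down (`1`) or up (`-1`). -/
noncomputable def descentMatrix {I : Type*} [DecidableEq I] (ρ : I → ℕ) (s : I → I) :
    Matrix I I (FreeAlgebra ℤ AB) :=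
  Matrix.diagonal fun x => if ρ (s x) < ρ x then 1 else -1

/-- The matrix of the downward steps of `s`. -/
noncomputable def stepMatrix {I : Type*} [DecidableEq I] (ρ : I → ℕ) (s : I → I) :
    Matrix I I (FreeAlgebra ℤ AB) :=
  Matrix.of fun u x => if ρ (s u) < ρ u ∧ s u = x then 1 else 0

theorem derivAB_map_mul {I : Type*} [Fintype I] (M M' : Matrix I I (FreeAlgebra ℤ AB)) :
    (M * M').map derivAB = M.map derivAB * M' + M * M'.map derivAB := by
  ext u x
  simp only [Matrix.map_apply, Matrix.add_apply, Matrix.mul_apply, map_sum, derivAB_mul,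
    Finset.sum_add_distrib]

theorem derivAB_map_add {I : Type*} (M M' : Matrix I I (FreeAlgebra ℤ AB)) :
    (M + M').map derivAB = M.map derivAB + M'.map derivAB := by
  ext u x
  simp only [Matrix.map_apply, Matrix.add_apply, map_add]

theorem stepMatrix_mul_apply {I : Type*} [Fintype I] [DecidableEq I] (ρ : I → ℕ) (s : I → I)
    (M : Matrix I I (FreeAlgebra ℤ AB)) (u x : I) :
    (stepMatrix ρ s * M) u x = if ρ (s u) < ρ u then M (s u) x else 0 := by
  simp only [Matrix.mul_apply, stepMatrix, Matrix.of_apply, ite_and, ite_mul, zero_mul, one_mul]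
  split_ifs <;> simp

/-! ### Matrix identities for ab-indices and special matchings. -/

section Matrices

variable {I : Type*} [PartialOrder I] {ρ : I → ℕ} {s : I → I}

theorem abMatrix_of_lt {u x : I} (h : u < x) : abMatrix I u x = abIndex (Set.Icc u x) := if_pos h

theorem abMatrix_of_not_lt {u x : I} (h : ¬ u < x) : abMatrix I u x = 0 := if_neg h

theorem powMatrix_of_lt {u x : I} (h : u < x) :
    powMatrix ρ u x = (varA - varB) ^ (ρ x - ρ u - 1) := if_pos h

theorem powMatrix_of_not_lt {u x : I} (h : ¬ u < x) : powMatrix ρ u x = 0 := if_neg h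

theorem IsSpecialMatching.lt_iff (hs : IsSpecialMatching ρ s) {u x : I}
    (hu : ρ u < ρ (s u)) (hx : ρ x < ρ (s x)) : s u < s x ↔ u < x := by
  have hinj : s u = s x ↔ u = x :=
    ⟨fun e => by rw [← hs.apply_apply u, e, hs.apply_apply], fun e => congrArg s e⟩
  rw [lt_iff_le_and_ne, lt_iff_le_and_ne, Ne, Ne, hinj]
  refine and_congr_left fun _ => ⟨fun h => ?_, hs.apply_le_apply u x hu hx⟩
  exact hs.le_of_le_apply u x hu hx ((hs.le_apply u hu).trans h)

variable [Fintype I] [DecidableEq I]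

theorem abMatrix_eq_right (h : IsRankFunction ρ) :
    abMatrix I = powMatrix ρ + abMatrix I * Matrix.diagonal (fun _ => varB) * powMatrix ρ := by
  classical
  ext u x
  rw [Matrix.add_apply, Matrix.mul_apply]
  simp only [Matrix.mul_diagonal]
  have hz : ∀ y, ¬ (u < y ∧ y < x) → abMatrix I u y * varB * powMatrix ρ y x = 0 := by
    intro y hy
    by_cases h1 : u < y
    · rw [powMatrix_of_not_lt (fun h2 => hy ⟨h1, h2⟩), mul_zero]
    · rw [abMatrix_of_not_lt h1, zero_mul, zero_mul]
  by_cases hux : u < x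
  · rw [abMatrix_of_lt hux, powMatrix_of_lt hux, h.abIndex_Icc_eq_sum hux]
    congr 1
    rw [Finset.sum_filter]
    refine Finset.sum_congr rfl fun y _ => ?_
    split_ifs with hy
    · rw [abMatrix_of_lt hy.1, powMatrix_of_lt hy.2]
    · exact (hz y hy).symm
  · rw [abMatrix_of_not_lt hux, powMatrix_of_not_lt hux, Finset.sum_eq_zero, add_zero]
    exact fun y _ => hz y fun hy => hux (hy.1.trans hy.2)

theorem isUnit_one_sub_powMatrix_mul (h : IsRankFunction ρ) :
    IsUnit (1 - powMatrix ρ * Matrix.diagonal (fun _ : I => varB)) := by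
  refine (isNilpotent_of_strictlyTriangular ρ fun u x hux => ?_).isUnit_one_sub
  rw [Matrix.mul_diagonal, powMatrix_of_not_lt fun hlt => (h.strictMono hlt).not_ge hux, zero_mul]

theorem isUnit_one_sub_mul_powMatrix (h : IsRankFunction ρ) :
    IsUnit (1 - Matrix.diagonal (fun _ : I => varB) * powMatrix ρ) := by
  refine (isNilpotent_of_strictlyTriangular ρ fun u x hux => ?_).isUnit_one_sub
  rw [Matrix.diagonal_mul, powMatrix_of_not_lt fun hlt => (h.strictMono hlt).not_ge hux, mul_zero]

/-- Sorting chains by their bottom element would give this too; algebraically, `(1 - e b)⁻¹ e = e (1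
- b e)⁻¹`. -/
theorem abMatrix_eq_left (h : IsRankFunction ρ) :
    abMatrix I = powMatrix ρ + powMatrix ρ * Matrix.diagonal (fun _ => varB) * abMatrix I := by
  have h1 := abMatrix_eq_right h
  set e := powMatrix ρ
  set ψ := abMatrix I
  set b : Matrix I I (FreeAlgebra ℤ AB) := Matrix.diagonal (fun _ => varB)
  rw [← sub_eq_zero]
  refine (isUnit_one_sub_mul_powMatrix h).mul_right_cancel ?_
  rw [zero_mul]
  linear_combination (norm := noncomm_ring) h1 - e * b * h1

/-- Differentiating `ψ = e + e b ψ` with `e' = 0` and `b' = d` gives `(1 - e b) ψ' = e d ψ = (1 - e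
b) ψ d ψ`. -/
theorem derivAB_map_abMatrix (h : IsRankFunction ρ) :
    (abMatrix I).map derivAB =
      abMatrix I * Matrix.diagonal (fun _ => varA * varB + varB * varA) * abMatrix I := by
  have h1 := abMatrix_eq_left h
  have he : (powMatrix ρ).map derivAB = 0 := by
    ext u x
    rw [Matrix.map_apply]
    by_cases hux : u < x
    · rw [powMatrix_of_lt hux, derivAB_sub_pow]; rfl
    · rw [powMatrix_of_not_lt hux, map_zero]; rfl
  have hb : (Matrix.diagonal (fun _ : I => varB)).map derivAB =
      Matrix.diagonal fun _ : I => varA * varB + varB * varA := by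
    rw [Matrix.diagonal_map (map_zero _)]
    simp only [derivAB_varB]
  have h2 : (abMatrix I).map derivAB = Matrix.map _ derivAB := congrArg (fun M => M.map derivAB) h1
  rw [derivAB_map_add, derivAB_map_mul, derivAB_map_mul, he, hb] at h2
  refine (isUnit_one_sub_powMatrix_mul h).mul_left_cancel ?_
  set e := powMatrix ρ
  set ψ := abMatrix I
  set b : Matrix I I (FreeAlgebra ℤ AB) := Matrix.diagonal (fun _ => varB)
  set d : Matrix I I (FreeAlgebra ℤ AB) := Matrix.diagonal fun _ => varA * varB + varB * varA
  linear_combination (norm := noncomm_ring) h2 - h1 * d * ψ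

theorem mul_stepMatrix_apply (hs : IsSpecialMatching ρ s) (M : Matrix I I (FreeAlgebra ℤ AB))
    (u x : I) :
    (M * stepMatrix ρ s) u x = if ρ x < ρ (s x) then M u (s x) else 0 := by
  rw [Matrix.mul_apply, Finset.sum_eq_single (s x)]
  · simp only [stepMatrix, Matrix.of_apply, hs.apply_apply, and_true]
    split_ifs <;> simp
  · intro y _ hy
    rw [stepMatrix, Matrix.of_apply, if_neg, mul_zero]
    rintro ⟨-, rfl⟩
    exact hy (hs.apply_apply y).symm
  · simp

/-- If `s` moves both ends in the same direction, the two terms on the left add up, and the factor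
`a - b` is exactly the effect of lengthening the interval by one step of `s`. If it moves them in
opposite directions, the left side cancels. The last term corrects the diagonal, where the
lengthened interval has length one and entry `1`. -/
theorem powMatrix_conj (h : IsRankFunction ρ) (hs : IsSpecialMatching ρ s) :
    Matrix.diagonal (fun _ : I => varA - varB) * descentMatrix ρ s * powMatrix ρ +
      powMatrix ρ * descentMatrix ρ s * Matrix.diagonal (fun _ : I => varA - varB) =
    2 * (stepMatrix ρ s * powMatrix ρ - powMatrix ρ * stepMatrix ρ s) - 2 * descentMatrix ρ s := by
  ext u x
  have hdiag : descentMatrix ρ s u x = if u = x then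
      (if ρ (s u) < ρ u then 1 else -1) else 0 := by
    rw [descentMatrix, Matrix.diagonal_apply]
  simp only [two_mul, Matrix.sub_apply, Matrix.add_apply, stepMatrix_mul_apply,
    mul_stepMatrix_apply hs, hdiag]
  simp only [descentMatrix, Matrix.diagonal_mul_diagonal, Matrix.diagonal_mul,
    Matrix.mul_diagonal]
  have hru := hs.rank_apply u
  have hrx := hs.rank_apply x
  have hsu := hs.apply_apply u
  have hsx := hs.apply_apply x
  have hmul : ∀ k : ℕ, (varA - varB) * (varA - varB) ^ k = (varA - varB) ^ (k + 1) :=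
    fun k => (pow_succ' _ _).symm
  have hmul' : ∀ k : ℕ, (varA - varB) ^ k * (varA - varB) = (varA - varB) ^ (k + 1) :=
    fun k => (pow_succ _ _).symm
  have hcomm : (varA - varB) * powMatrix ρ u x = powMatrix ρ u x * (varA - varB) := by
    by_cases hux : u < x
    · rw [powMatrix_of_lt hux, hmul, hmul']
    · rw [powMatrix_of_not_lt hux, mul_zero, zero_mul]
  have hne : ∀ y, s y ≠ y := by
    intro y hy
    have := hs.rank_apply y
    rw [hy] at this
    omega
  by_cases hu : ρ u < ρ (s u) <;> by_cases hx : ρ x < ρ (s x)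
  · rw [if_neg hu.not_gt, if_neg hx.not_gt, if_neg hu.not_gt, if_pos hx, mul_neg_one, neg_mul,
      mul_neg_one, neg_mul, hcomm]
    rcases eq_or_ne u x with rfl | hne'
    · rw [powMatrix_of_not_lt (lt_irrefl u), if_pos rfl,
        powMatrix_of_lt (lt_of_le_of_ne (hs.le_apply u hu) (hne u).symm),
        show ρ (s u) - ρ u - 1 = 0 by omega]
      simp
    · rw [if_neg hne']
      by_cases hux : u < x
      · have := h.strictMono hux
        rw [powMatrix_of_lt hux, powMatrix_of_lt (hux.trans_le (hs.le_apply x hx)), hmul',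
          show ρ (s x) - ρ u - 1 = ρ x - ρ u - 1 + 1 by omega]
        simp [sub_eq_add_neg]
      · rw [powMatrix_of_not_lt hux, powMatrix_of_not_lt fun hlt =>
          hux (lt_of_le_of_ne (hs.le_of_le_apply u x hu hx hlt.le) hne')]
        simp
  · have hx' : ρ (s x) < ρ x := by omega
    have hne' : u ≠ x := by rintro rfl; exact hx hu
    rw [if_neg hu.not_gt, if_pos hx', if_neg hu.not_gt, if_neg hx, if_neg hne', mul_neg_one,
      neg_mul, mul_one, hcomm]
    simp
  · have hu' : ρ (s u) < ρ u := by omega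
    have hne' : u ≠ x := by rintro rfl; exact hu hx
    have hlt := hs.lt_iff (u := s u) (x := x) (by rw [hsu]; exact hu') hx
    rw [hsu] at hlt
    -- Applying `s` to both ends preserves the strict order here, and the two intervals have equal
    -- length.
    have he : powMatrix ρ (s u) x = powMatrix ρ u (s x) := by
      by_cases hux : u < s x
      · rw [powMatrix_of_lt hux, powMatrix_of_lt (hlt.1 hux)]
        congr 1
        omega
      · rw [powMatrix_of_not_lt hux, powMatrix_of_not_lt (mt hlt.2 hux)]
    rw [if_pos hu', if_neg hx.not_gt, if_pos hu', if_pos hx, if_neg hne', mul_neg_one,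
      neg_mul_comm, mul_one, mul_neg, hcomm, he]
    simp
  · have hu' : ρ (s u) < ρ u := by omega
    have hx' : ρ (s x) < ρ x := by omega
    have hsule : s u ≤ u := by
      have := hs.le_apply (s u) (by rw [hsu]; exact hu')
      rwa [hsu] at this
    rw [if_pos hu', if_pos hx', if_pos hu', if_neg hx, mul_one, mul_one, hcomm]
    rcases eq_or_ne u x with rfl | hne'
    · rw [powMatrix_of_not_lt (lt_irrefl u), if_pos rfl,
        powMatrix_of_lt (lt_of_le_of_ne hsule (hne u)), show ρ u - ρ (s u) - 1 = 0 by omega]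
      simp
    · rw [if_neg hne']
      by_cases hux : u < x
      · have := h.strictMono hux
        rw [powMatrix_of_lt hux, powMatrix_of_lt (hsule.trans_lt hux), hmul',
          show ρ x - ρ (s u) - 1 = ρ x - ρ u - 1 + 1 by omega]
        simp
      · rw [powMatrix_of_not_lt hux, powMatrix_of_not_lt]
        · simp
        · intro hlt
          have h1 := hs.le_of_le_apply (s u) (s x) (by rw [hsu]; exact hu')
            (by rw [hsx]; exact hx') (by rw [hsx]; exact hlt.le)
          have h2 := hs.apply_le_apply (s u) (s x) (by rw [hsu]; exact hu')
            (by rw [hsx]; exact hx') h1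
          rw [hsu, hsx] at h2
          exact hux (lt_of_le_of_ne h2 hne')

theorem abMatrix_conj (h : IsRankFunction ρ) (hs : IsSpecialMatching ρ s) :
    Matrix.diagonal (fun _ : I => varA + varB) * descentMatrix ρ s * abMatrix I +
      abMatrix I * descentMatrix ρ s * Matrix.diagonal (fun _ : I => varA + varB) +
      abMatrix I * Matrix.diagonal (fun _ : I => varA * varB + varB * varA) *
        descentMatrix ρ s * abMatrix I =
    2 * (stepMatrix ρ s * abMatrix I - abMatrix I * stepMatrix ρ s) - 2 * descentMatrix ρ s := by
  have hE : ∀ f : FreeAlgebra ℤ AB, descentMatrix ρ s * Matrix.diagonal (fun _ => f) =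
      Matrix.diagonal (fun _ => f) * descentMatrix ρ s := by
    intro f
    rw [descentMatrix, Matrix.diagonal_mul_diagonal, Matrix.diagonal_mul_diagonal]
    congr 1
    ext x
    split_ifs <;> simp
  have hN : stepMatrix ρ s * Matrix.diagonal (fun _ => varB) =
      Matrix.diagonal (fun _ => varB) * stepMatrix ρ s := by
    ext u x
    rw [Matrix.mul_diagonal, Matrix.diagonal_mul, stepMatrix, Matrix.of_apply]
    split_ifs <;> simp
  have key := conj_identity (abMatrix_eq_left h) (abMatrix_eq_right h) (hE varB)
    (hE (varA - varB)) hN (powMatrix_conj h hs) (isUnit_one_sub_powMatrix_mul h)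
    (isUnit_one_sub_mul_powMatrix h)
  -- With `t = a - b`, the combinations in `conj_identity` become `t + 2b = c` and `bt + tb + 2b² =
  -- d`.
  have hc : Matrix.diagonal (fun _ : I => varA - varB) + 2 * Matrix.diagonal (fun _ : I => varB) =
      Matrix.diagonal (fun _ : I => varA + varB) := by
    rw [two_mul, Matrix.diagonal_add, Matrix.diagonal_add]
    congr 1
    ext x
    noncomm_ring
  have hd : Matrix.diagonal (fun _ : I => varB) * Matrix.diagonal (fun _ : I => varA - varB) +
      Matrix.diagonal (fun _ : I => varA - varB) * Matrix.diagonal (fun _ : I => varB) +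
      2 * (Matrix.diagonal (fun _ : I => varB) * Matrix.diagonal (fun _ : I => varB)) =
      Matrix.diagonal (fun _ : I => varA * varB + varB * varA) := by
    simp only [two_mul, Matrix.diagonal_mul_diagonal, Matrix.diagonal_add]
    congr 1
    ext x
    noncomm_ring
  rw [hc, hd] at key
  exact key

end Matrices

end CDIndex

/-! ### The cd-index under special matchings -/

namespace CDIndex

section Matching

variable {I : Type*} [PartialOrder I] {ρ : I → ℕ} {s : I → I}

theorem two_mul_left_cancel {p q : FreeAlgebra ℤ AB} (h : 2 * p = 2 * q) : p = q := by
  have h2 : (2 : FreeAlgebra ℤ AB) ≠ 0 := by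
    intro h0
    have h1 : algebraMap ℤ (FreeAlgebra ℤ AB) 2 = 0 := by rw [map_ofNat, h0]
    rw [FreeAlgebra.algebraMap_eq_zero_iff] at h1
    omega
  exact mul_left_cancel₀ h2 h

/-- Nothing is known about `F u v` unless `v ≤ x`, but otherwise the factor from `v` to `x`
vanishes. -/
theorem substAB_mul_varD_mul {x : I} {F : I → I → FreeAlgebra ℤ CD}
    (hF : ∀ v w, w ≤ x → substAB (F v w) = abMatrix I v w) (u v : I) :
    substAB (F u v * varD * F v x) =
      abMatrix I u v * (varA * varB + varB * varA) * abMatrix I v x := by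
  rw [map_mul, map_mul, substAB_varD, hF v x le_rfl]
  by_cases hv : v < x
  · rw [hF u v hv.le]
  · rw [abMatrix_of_not_lt hv, mul_zero, mul_zero]

theorem abIndex_Icc_of_rank_eq (h : IsRankFunction ρ) {u x : I} (hux : u < x)
    (hr : ρ x = ρ u + 1) : abIndex (Set.Icc u x) = 1 := by
  rw [h.abIndex_Icc hux.le, show ρ x - ρ u - 1 = 0 by omega, abTransform_zero,
    card_chainsIcc_empty]
  simp

variable [Fintype I] [DecidableEq I]

theorem derivAB_abMatrix_apply (h : IsRankFunction ρ) (u x : I) :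
    derivAB (abMatrix I u x) =
      ∑ v, abMatrix I u v * (varA * varB + varB * varA) * abMatrix I v x := by
  have := congrFun (congrFun (derivAB_map_abMatrix h) u) x
  rw [Matrix.map_apply, Matrix.mul_apply] at this
  simpa only [Matrix.mul_diagonal] using this

theorem abMatrix_conj_apply (h : IsRankFunction ρ) (hs : IsSpecialMatching ρ s) {u x : I}
    (hux : u ≠ x) :
    (varA + varB) * (if ρ (s u) < ρ u then 1 else -1) * abMatrix I u x +
      abMatrix I u x * (if ρ (s x) < ρ x then 1 else -1) * (varA + varB) +
      ∑ v, abMatrix I u v * (varA * varB + varB * varA) * (if ρ (s v) < ρ v then 1 else -1) *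
        abMatrix I v x =
    2 * ((if ρ (s u) < ρ u then abMatrix I (s u) x else 0) -
      if ρ x < ρ (s x) then abMatrix I u (s x) else 0) := by
  have := congrFun (congrFun (abMatrix_conj h hs) u) x
  simp only [two_mul, Matrix.sub_apply, Matrix.add_apply, stepMatrix_mul_apply,
    mul_stepMatrix_apply hs] at this
  simp only [descentMatrix, Matrix.diagonal_mul_diagonal, Matrix.diagonal_mul,
    Matrix.mul_diagonal, Matrix.diagonal_apply_ne _ hux, add_zero, sub_zero] at this
  rw [Matrix.mul_apply] at this
  simp only [Matrix.mul_diagonal] at this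
  rw [two_mul]
  exact this

/-- The cd-index of `[u, s x]` when `s` moves both `u` and `x` up. -/
theorem substAB_pyr_sub (h : IsRankFunction ρ) (hs : IsSpecialMatching ρ s)
    {F : I → I → FreeAlgebra ℤ CD} {u x : I} (hu : ρ u < ρ (s u)) (hx : ρ x < ρ (s x))
    (hux : u < x) (hF : ∀ v w, w ≤ x → substAB (F v w) = abMatrix I v w) :
    substAB (pyr (F u x) - ∑ v with ρ (s v) < ρ v, F u v * varD * F v x) =
      abMatrix I u (s x) := by
  have h1 := abMatrix_conj_apply h hs hux.ne
  rw [if_neg hu.not_gt, if_neg hx.not_gt, if_neg hu.not_gt, if_pos hx] at h1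
  have h2 := two_mul_substAB_derivCD (F u x)
  rw [hF u x le_rfl, derivAB_abMatrix_apply h] at h2
  -- A signed sum is twice its positive part minus the full sum, and the full sum is the derivative
  -- of the ab-index.
  have h3 : ∑ v, abMatrix I u v * (varA * varB + varB * varA) *
        (if ρ (s v) < ρ v then 1 else -1) * abMatrix I v x =
      2 * substAB (∑ v with ρ (s v) < ρ v, F u v * varD * F v x) -
      ∑ v, abMatrix I u v * (varA * varB + varB * varA) * abMatrix I v x := by
    rw [map_sum, Finset.sum_filter, Finset.mul_sum, ← Finset.sum_sub_distrib]
    refine Finset.sum_congr rfl fun v _ => ?_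
    rw [substAB_mul_varD_mul hF]
    split_ifs <;> noncomm_ring
  rw [h3] at h1
  apply two_mul_left_cancel
  rw [map_sub, pyr_apply, map_add, map_mul, substAB_varC, hF u x le_rfl]
  linear_combination (norm := noncomm_ring) h2 - h1

/-- The cd-index of `[u, s x]` when `s` moves `u` down and `x` up. -/
theorem substAB_sub_derivCD_add (h : IsRankFunction ρ) (hs : IsSpecialMatching ρ s)
    {F : I → I → FreeAlgebra ℤ CD} {u x : I} (hu : ρ (s u) < ρ u) (hx : ρ x < ρ (s x))
    (hF : ∀ v w, w ≤ x → substAB (F v w) = abMatrix I v w) :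
    substAB (F (s u) x - derivCD (F u x) + ∑ v with ¬ ρ (s v) < ρ v, F u v * varD * F v x) =
      abMatrix I u (s x) := by
  have hne : u ≠ x := by rintro rfl; exact hx.not_gt hu
  have h1 := abMatrix_conj_apply h hs hne
  rw [if_pos hu, if_neg hx.not_gt, if_pos hu, if_pos hx] at h1
  have h2 := two_mul_substAB_derivCD (F u x)
  rw [hF u x le_rfl, derivAB_abMatrix_apply h] at h2
  -- Here the part with sign `-1` is isolated, since the full sum is needed with a plus sign to form
  -- `derivCD`.
  have h3 : ∑ v, abMatrix I u v * (varA * varB + varB * varA) *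
        (if ρ (s v) < ρ v then 1 else -1) * abMatrix I v x =
      ∑ v, abMatrix I u v * (varA * varB + varB * varA) * abMatrix I v x -
      2 * substAB (∑ v with ¬ ρ (s v) < ρ v, F u v * varD * F v x) := by
    rw [map_sum, Finset.sum_filter, Finset.mul_sum, ← Finset.sum_sub_distrib]
    refine Finset.sum_congr rfl fun v _ => ?_
    rw [substAB_mul_varD_mul hF]
    split_ifs <;> first | contradiction | noncomm_ring
  rw [h3] at h1
  apply two_mul_left_cancel
  rw [map_add, map_sub, hF (s u) x le_rfl]
  linear_combination (norm := noncomm_ring) -h1 - h2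

open Classical in
-- Existence and recursion of cd-indices along a special matching.
/-- The matrix of the cd-indices of the nontrivial intervals of a poset. -/
noncomputable def cdMatrix (I : Type*) [PartialOrder I] (u x : I) : FreeAlgebra ℤ CD :=
  if u < x then cdIndex (Set.Icc u x) else 0

theorem substAB_cdMatrix {I : Type*} [PartialOrder I] {u x : I}
    (h : u < x → HasCDIndex (Set.Icc u x)) : substAB (cdMatrix I u x) = abMatrix I u x := by
  by_cases hux : u < x
  · rw [cdMatrix, if_pos hux, abMatrix_of_lt hux, substAB_cdIndex (h hux)]
  · rw [cdMatrix, if_neg hux, abMatrix_of_not_lt hux, map_zero]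

theorem hasCDIndex_of_abIndex_eq_one {P : Type*} [PartialOrder P] (h : abIndex P = 1) :
    HasCDIndex P := hasCDIndex_of_substAB_eq (Φ := 1) (by rw [map_one, h])

theorem hasCDIndex_Icc_apply (h : IsRankFunction ρ) (hs : IsSpecialMatching ρ s) {x : I}
    (hx : ρ x < ρ (s x)) (hcd : ∀ v w, w ≤ x → v < w → HasCDIndex (Set.Icc v w)) {u : I}
    (hu : u ≤ s x) : HasCDIndex (Set.Icc u (s x)) := by
  have hF : ∀ v w, w ≤ x → substAB (cdMatrix I v w) = abMatrix I v w :=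
    fun v w hw => substAB_cdMatrix (hcd v w hw)
  rcases eq_or_lt_of_le hu with rfl | hu
  · exact hasCDIndex_of_abIndex_eq_one (h.abIndex_Icc_self _)
  rcases hs.rank_apply u with hu' | hu'
  -- The pyramid formula needs `u < x`; for `u = x` the interval is a single covering step.
  · rcases eq_or_lt_of_le (hs.le_of_le_apply u x (by omega) hx hu.le) with rfl | hux
    · exact hasCDIndex_of_abIndex_eq_one (abIndex_Icc_of_rank_eq h hu hu')
    · exact hasCDIndex_of_substAB_eq
        ((substAB_pyr_sub h hs (by omega) hx hux hF).trans (abMatrix_of_lt hu))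
  · exact hasCDIndex_of_substAB_eq
      ((substAB_sub_derivCD_add h hs (by omega) hx hF).trans (abMatrix_of_lt hu))

theorem cdIndex_Icc_apply (h : IsRankFunction ρ) (hs : IsSpecialMatching ρ s) {u x : I}
    (hu : ρ u < ρ (s u)) (hx : ρ x < ρ (s x)) (hux : u < x)
    (hcd : ∀ v w, w ≤ x → v < w → HasCDIndex (Set.Icc v w)) :
    cdIndex (Set.Icc u (s x)) = pyr (cdIndex (Set.Icc u x)) -
      ∑ v with ρ (s v) < ρ v, cdMatrix I u v * varD * cdMatrix I v x := by
  apply cdIndex_eq_of_substAB_eq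
  have hus := hux.trans_le (hs.le_apply x hx)
  rw [← abMatrix_of_lt hus, ← substAB_pyr_sub h hs hu hx hux (F := cdMatrix I)
    fun v w hw => substAB_cdMatrix (hcd v w hw), cdMatrix, if_pos hux]

end Matching

end CDIndex

/-! ### Bruhat intervals -/

namespace CoxeterSystem

open CDIndex

variable {B W : Type*} [Group W] {M : CoxeterMatrix B} (cs : CoxeterSystem M W)

theorem one_bruhatLE (w : W) : cs.BruhatLE 1 w := by
  obtain ⟨ω, hω, rfl⟩ := cs.exists_isReduced w
  exact ⟨ω, hω, rfl, [], List.nil_sublist ω, by simp [IsReduced], by simp⟩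

/-- The definition provides one reduced word of the upper element; by strong exchange any word will
do, reduced or not. -/
theorem exists_sublist_of_bruhatLE {u : W} {ω : List B} (h : cs.BruhatLE u (cs.wordProd ω)) :
    ∃ η : List B, η.Sublist ω ∧ cs.IsReduced η ∧ cs.wordProd η = u := by
  obtain ⟨η, hs, rfl⟩ :=
    cs.exists_sublist_of_reflTransGen (cs.bruhatLE_iff_reflTransGen.1 h) ω rfl
  obtain ⟨θ, hs', hr, hp⟩ := cs.exists_reduced_sublist η
  exact ⟨θ, hs'.trans hs, hr, hp⟩

theorem bruhatLE_of_sublist {η ω : List B} (h : η.Sublist ω) (hω : cs.IsReduced ω) :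
    cs.BruhatLE (cs.wordProd η) (cs.wordProd ω) :=
  cs.bruhatLE_iff_reflTransGen.2 (cs.reflTransGen_of_sublist h hω)

theorem finite_setOf_bruhatLE (w : W) : {u | cs.BruhatLE u w}.Finite := by
  obtain ⟨ω, hω, rfl⟩ := cs.exists_isReduced w
  refine ((List.finite_toSet ω.sublists).image cs.wordProd).subset fun u hu => ?_
  obtain ⟨η, hη, -, rfl⟩ := cs.exists_sublist_of_bruhatLE hu
  exact Set.mem_image_of_mem _ (List.mem_sublists.2 hη)

instance (u v : W) : Finite (cs.BruhatInterval u v) :=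
  ((cs.finite_setOf_bruhatLE v).subset fun _ hx => hx.2 :
    {x | cs.BruhatLE u x ∧ cs.BruhatLE x v}.Finite)

theorem BruhatLE.length_lt {u v : W} (h : cs.BruhatLE u v) (hne : u ≠ v) :
    cs.length u < cs.length v := by
  obtain ⟨ω, hω, rfl, η, hs, hη, rfl⟩ := h
  rw [hω.eq, hη.eq]
  refine lt_of_le_of_ne hs.length_le fun he => hne ?_
  rw [hs.eq_of_length he]

theorem bruhatLE_simple_mul {u : W} {i : B} (h : cs.length u < cs.length (cs.simple i * u)) :
    cs.BruhatLE u (cs.simple i * u) :=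
  cs.bruhatLE_iff_reflTransGen.2 (.single ⟨u⁻¹ * cs.simple i * u, ⟨u⁻¹, i, by group⟩, by group, h⟩)

theorem BruhatLE.simple_mul {u v : W} (i : B) (h : cs.BruhatLE u v) :
    cs.BruhatLE (cs.simple i * u) v ∨ cs.BruhatLE (cs.simple i * u) (cs.simple i * v) := by
  simp only [bruhatLE_iff_reflTransGen] at h ⊢
  exact cs.reflTransGen_simple_mul i h

theorem BruhatLE.simple_mul_le {u v : W} {i : B} (h : cs.BruhatLE u v)
    (hv : cs.length v < cs.length (cs.simple i * v)) :
    cs.BruhatLE (cs.simple i * u) (cs.simple i * v) :=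
  (BruhatLE.simple_mul cs i h).elim (fun h' => BruhatLE.trans cs h' (cs.bruhatLE_simple_mul hv)) id

/-- A reduced subword of `i :: ω` that uses the initial `i` would make `i` a left descent of `u`; so
the subword already lies in `ω`. -/
theorem BruhatLE.of_le_simple_mul {u v : W} {i : B}
    (hu : cs.length u < cs.length (cs.simple i * u))
    (hv : cs.length v < cs.length (cs.simple i * v)) (h : cs.BruhatLE u (cs.simple i * v)) :
    cs.BruhatLE u v := by
  obtain ⟨ω, hω, rfl⟩ := cs.exists_isReduced v
  rw [← wordProd_cons] at h
  obtain ⟨η, hs, hη, rfl⟩ := cs.exists_sublist_of_bruhatLE h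
  cases hs with
  | cons _ hs => exact cs.bruhatLE_of_sublist hs hω
  | cons_cons _ hs =>
    rename_i η
    have h1 := cs.length_wordProd_le η
    have h2 := hη.eq
    rw [wordProd_cons, simple_mul_simple_cancel_left, ← wordProd_cons] at hu
    rw [List.length_cons] at h2
    omega

/-- Write `v = i q` with `i` a left descent. If `i` moves `u` up, then `u ≤ q` and `q` works.
Otherwise `u = i p` with `p < q`, and induction gives `z` between `p` and `q`, one below `q`: if `i`
moves `z` up, then `i z` works. -/
theorem BruhatLE.exists_pred {u v : W} (h : cs.BruhatLE u v) (hne : u ≠ v) :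
    ∃ w, cs.BruhatLE u w ∧ cs.BruhatLE w v ∧ cs.length w + 1 = cs.length v := by
  obtain ⟨n, hn⟩ : ∃ n, cs.length v = n := ⟨_, rfl⟩
  induction n generalizing u v with
  | zero =>
    have := BruhatLE.length_lt cs h hne
    omega
  | succ n ih =>
    have hv1 : v ≠ 1 := by rintro rfl; simp at hn
    obtain ⟨i, hi⟩ := cs.exists_leftDescent_of_ne_one hv1
    obtain ⟨q, rfl⟩ : ∃ q, v = cs.simple i * q := ⟨cs.simple i * v, by simp⟩
    have hq := (cs.isLeftDescent_iff.1 hi)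
    rw [simple_mul_simple_cancel_left] at hq
    have hq' : cs.length q < cs.length (cs.simple i * q) := by omega
    have hfin : cs.BruhatLE u q → ∃ w, cs.BruhatLE u w ∧ cs.BruhatLE w (cs.simple i * q) ∧
        cs.length w + 1 = cs.length (cs.simple i * q) :=
      fun huq => ⟨q, huq, cs.bruhatLE_simple_mul hq', hq⟩
    rcases cs.length_simple_mul u i with hu | hu
    · exact hfin (BruhatLE.of_le_simple_mul cs (by omega) hq' h)
    · obtain ⟨p, rfl⟩ : ∃ p, u = cs.simple i * p := ⟨cs.simple i * u, by simp⟩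
      rw [simple_mul_simple_cancel_left] at hu
      have hp : cs.length p < cs.length (cs.simple i * p) := by omega
      have hpq : cs.BruhatLE p q := BruhatLE.of_le_simple_mul cs hp hq'
        (BruhatLE.trans cs (cs.bruhatLE_simple_mul hp) h)
      obtain ⟨z, hpz, hzq, hz⟩ := ih hpq (fun e => hne (by rw [e])) (by omega)
      rcases cs.length_simple_mul z i with hz' | hz'
      · exact ⟨cs.simple i * z, BruhatLE.simple_mul_le cs hpz (by omega),
          BruhatLE.simple_mul_le cs hzq hq', by omega⟩
      -- If `i` moves `z` down, lifting puts `u` below `z`, hence below `q`, and `q` works again.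
      · have h1 : cs.BruhatLE (cs.simple i * p) z := by
          rcases BruhatLE.simple_mul cs i hpz with h | h
          · exact h
          · have h2 := cs.bruhatLE_simple_mul (u := cs.simple i * z) (i := i)
              (by rw [simple_mul_simple_cancel_left]; omega)
            rw [simple_mul_simple_cancel_left] at h2
            exact BruhatLE.trans cs h h2
        exact hfin (BruhatLE.trans cs h1 hzq)

theorem isRankFunction_length (u y : W) :
    IsRankFunction fun x : cs.BruhatInterval u y => cs.length x.1 where
  strictMono x z h := BruhatLE.length_lt cs h.le fun e => h.ne (Subtype.ext e)
  exists_pred x z h := by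
    obtain ⟨w, h1, h2, h3⟩ := BruhatLE.exists_pred cs (show cs.BruhatLE x.1 z.1 from h.le)
      fun e => h.ne (Subtype.ext e)
    refine ⟨⟨w, BruhatLE.trans cs x.2.1 h1, BruhatLE.trans cs h2 z.2.2⟩, h1,
      lt_of_le_of_ne h2 ?_, h3⟩
    intro e
    have : w = z.1 := congrArg Subtype.val e
    rw [this] at h3
    omega

/-- Left multiplication by a left descent of `y`, as a map on the lower interval of `y`. -/
def leftMulInterval {y : W} {i : B} (hi : cs.IsLeftDescent y i) (x : cs.BruhatInterval 1 y) :
    cs.BruhatInterval 1 y :=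
  ⟨cs.simple i * x.1, cs.one_bruhatLE _, by
    rcases BruhatLE.simple_mul cs i x.2.2 with h | h
    · exact h
    · have h1 := cs.bruhatLE_simple_mul (u := cs.simple i * y) (i := i)
        (by rw [simple_mul_simple_cancel_left]; exact hi)
      rw [simple_mul_simple_cancel_left] at h1
      exact BruhatLE.trans cs h h1⟩

theorem isSpecialMatching_leftMulInterval {y : W} {i : B} (hi : cs.IsLeftDescent y i) :
    IsSpecialMatching (fun x : cs.BruhatInterval 1 y => cs.length x.1)
      (cs.leftMulInterval hi) where
  apply_apply _ := Subtype.ext (cs.simple_mul_simple_cancel_left i)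
  rank_apply x := cs.length_simple_mul x.1 i
  le_apply _ hx := cs.bruhatLE_simple_mul hx
  le_of_le_apply _ _ hx hz h := BruhatLE.of_le_simple_mul cs hx hz h
  apply_le_apply _ _ _ hz h := BruhatLE.simple_mul_le cs h hz

/-- An element below `y`, as an element of the lower interval of `y`. -/
def toLowerInterval {u y : W} (hu : cs.BruhatLE u y) : cs.BruhatInterval 1 y :=
  ⟨u, cs.one_bruhatLE u, hu⟩

/-- Bruhat intervals as intervals of a lower interval. -/
def bruhatIntervalIso {u v y : W} (hu : cs.BruhatLE u y) (hv : cs.BruhatLE v y) :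
    Set.Icc (cs.toLowerInterval hu) (cs.toLowerInterval hv) ≃o
      cs.BruhatInterval u v where
  toFun x := ⟨x.1.1, x.2.1, x.2.2⟩
  invFun x := ⟨cs.toLowerInterval (BruhatLE.trans cs x.2.2 hv), x.2.1, x.2.2⟩
  left_inv _ := rfl
  right_inv _ := rfl
  map_rel_iff' := Iff.rfl

theorem abIndex_bruhatInterval_self (u : W) : abIndex (cs.BruhatInterval u u) = 1 := by
  rw [← abIndex_congr (cs.bruhatIntervalIso (cs.bruhatLE_refl u) (cs.bruhatLE_refl u))]
  exact (cs.isRankFunction_length 1 u).abIndex_Icc_self _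

/-- The induction is on the length of `v` for all `u` at once. The matching lives on `[1, v]`,
because left multiplication by a descent of `v` need not preserve `[u, v]`. -/
theorem hasCDIndex_bruhatInterval {u v : W} (h : cs.BruhatLE u v) :
    HasCDIndex (cs.BruhatInterval u v) := by
  classical
  obtain ⟨n, hn⟩ : ∃ n, cs.length v = n := ⟨_, rfl⟩
  induction n using Nat.strong_induction_on generalizing u v with
  | _ n ih =>
    by_cases hv1 : v = 1
    · have : u = v := by
        subst hv1
        exact BruhatLE.antisymm cs h (cs.one_bruhatLE u)
      subst this
      exact hasCDIndex_of_abIndex_eq_one (cs.abIndex_bruhatInterval_self u)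
    obtain ⟨i, hi⟩ := cs.exists_leftDescent_of_ne_one hv1
    have := Fintype.ofFinite (cs.BruhatInterval 1 v)
    have hs := cs.isSpecialMatching_leftMulInterval hi
    have hr := cs.isRankFunction_length 1 v
    let y := cs.toLowerInterval (cs.bruhatLE_refl v)
    have hy : cs.leftMulInterval hi (cs.leftMulInterval hi y) = y := hs.apply_apply y
    have hlt : cs.length (cs.simple i * v) < cs.length v := hi
    have key := hasCDIndex_Icc_apply hr hs (x := cs.leftMulInterval hi y)
      (u := cs.toLowerInterval h) (by rw [hy]; exact hi) (by
        intro z w hw hzw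
        have h1 : cs.length w.1 ≤ cs.length (cs.simple i * v) := hr.strictMono.monotone hw
        exact (hasCDIndex_congr (cs.bruhatIntervalIso z.2.2 w.2.2)).2
          (ih (cs.length w.1) (by omega) hzw.le rfl)) (by rw [hy]; exact h)
    rw [hy] at key
    exact (hasCDIndex_congr (cs.bruhatIntervalIso h (cs.bruhatLE_refl v))).1 key

theorem cdIndex_bruhatInterval_of_length_le_one {w : W} (hw : cs.length w ≤ 1) :
    cdIndex (cs.BruhatInterval 1 w) = 1 := by
  apply cdIndex_eq_of_substAB_eq
  rw [map_one]
  rcases Nat.eq_zero_or_pos (cs.length w) with h | h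
  · rw [cs.length_eq_zero_iff.1 h, abIndex_bruhatInterval_self]
  · rw [← abIndex_congr (cs.bruhatIntervalIso (cs.one_bruhatLE w) (cs.bruhatLE_refl w))]
    have hne : (1 : W) ≠ w := by rintro rfl; simp at h
    refine (abIndex_Icc_of_rank_eq (cs.isRankFunction_length 1 w)
      (lt_of_le_of_ne (cs.one_bruhatLE w) fun e => hne (congrArg Subtype.val e)) ?_).symm
    change cs.length w = cs.length 1 + 1
    rw [cs.length_one]
    omega

/-- Up to a cd-polynomial with nonnegative coefficients, the cd-index of a lower interval is bounded
by the pyramid of the cd-index of a smaller lower interval. -/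
theorem pyr_sub_cdIndex_mem_nonnegCD (hnonneg : cs.CDNonneg) {w : W} {i : B}
    (hi : cs.IsLeftDescent w i) (hw : cs.simple i * w ≠ 1) :
    pyr (cdIndex (cs.BruhatInterval 1 (cs.simple i * w))) - cdIndex (cs.BruhatInterval 1 w) ∈
      nonnegCD := by
  classical
  have := Fintype.ofFinite (cs.BruhatInterval 1 w)
  have hs := cs.isSpecialMatching_leftMulInterval hi
  have hr := cs.isRankFunction_length 1 w
  let y := cs.toLowerInterval (cs.bruhatLE_refl w)
  let o := cs.toLowerInterval (cs.one_bruhatLE w)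
  have hy : cs.leftMulInterval hi (cs.leftMulInterval hi y) = y := hs.apply_apply y
  have hcd : ∀ z x : cs.BruhatInterval 1 w, z < x → HasCDIndex (Set.Icc z x) := fun z x hzx =>
    (hasCDIndex_congr (cs.bruhatIntervalIso z.2.2 x.2.2)).2 (cs.hasCDIndex_bruhatInterval hzx.le)
  have key := cdIndex_Icc_apply hr hs (u := o) (x := cs.leftMulInterval hi y)
    (by
      change cs.length 1 < cs.length (cs.simple i * 1)
      rw [mul_one, cs.length_one, cs.length_simple]
      exact one_pos)
    (by rw [hy]; exact hi)
    (lt_of_le_of_ne (cs.one_bruhatLE _) fun e => hw (congrArg Subtype.val e).symm)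
    fun z x _ => hcd z x
  rw [hy] at key
  have e1 := cdIndex_congr (cs.bruhatIntervalIso (cs.one_bruhatLE w) (cs.bruhatLE_refl w))
  have e2 := cdIndex_congr
    (cs.bruhatIntervalIso (cs.one_bruhatLE w) (cs.leftMulInterval hi y).2.2)
  have key' : cdIndex (cs.BruhatInterval 1 w) =
      pyr (cdIndex (cs.BruhatInterval 1 (cs.simple i * w))) - _ :=
    e1.symm.trans (key.trans (congrArg (fun Φ => pyr Φ - _) e2))
  -- Only the subtracted sum of products remains, and the nonnegativity hypothesis applies to the
  -- two cd-index factors of each summand.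
  rw [key', sub_sub_cancel]
  have hmem : ∀ z x : cs.BruhatInterval 1 w, cdMatrix (cs.BruhatInterval 1 w) z x ∈ nonnegCD := by
    intro z x
    rw [cdMatrix]
    split_ifs with hzx
    · have e : cdIndex (Set.Icc z x) = cdIndex (cs.BruhatInterval z.1 x.1) :=
        cdIndex_congr (cs.bruhatIntervalIso z.2.2 x.2.2)
      rw [e, mem_nonnegCD_iff]
      exact hnonneg _ _ hzx.le
    · exact zero_mem _
  exact sum_mem fun z _ => mul_mem (mul_mem (hmem _ _) varD_mem_nonnegCD) (hmem _ _)

end CoxeterSystem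

/-! ### Boolean algebras -/

namespace CDIndex

section Boolean

variable {α : Type*}

theorem isRankFunction_ncard (α : Type*) [Finite α] :
    IsRankFunction (Set.ncard : Set α → ℕ) where
  strictMono s t h := Set.ncard_lt_ncard h
  exists_pred s t h := by
    obtain ⟨a, hat, has⟩ := Set.exists_of_ssubset h
    exact ⟨t \ {a}, Set.subset_sdiff_singleton h.le has,
      ⟨Set.sdiff_subset, fun h' => (h' hat).2 rfl⟩, Set.ncard_sdiff_singleton_add_one hat⟩

open Classical in
/-- The involution on subsets that adds or removes `a`. -/
noncomputable def toggle (a : α) (s : Set α) : Set α := if a ∈ s then s \ {a} else insert a s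

theorem toggle_of_mem {a : α} {s : Set α} (h : a ∈ s) : toggle a s = s \ {a} := if_pos h

theorem toggle_of_notMem {a : α} {s : Set α} (h : a ∉ s) : toggle a s = insert a s := if_neg h

variable [Finite α]

theorem ncard_lt_ncard_toggle_iff {a : α} {s : Set α} :
    s.ncard < (toggle a s).ncard ↔ a ∉ s := by
  by_cases h : a ∈ s
  · rw [toggle_of_mem h]
    have := Set.ncard_sdiff_singleton_add_one h
    simp only [h, not_true_eq_false, iff_false]
    omega
  · rw [toggle_of_notMem h, Set.ncard_insert_of_notMem h]
    simp [h]

theorem isSpecialMatching_toggle (a : α) :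
    IsSpecialMatching (Set.ncard : Set α → ℕ) (toggle a) where
  apply_apply s := by
    by_cases h : a ∈ s
    · rw [toggle_of_mem h, toggle_of_notMem (by simp), Set.insert_sdiff_singleton,
        Set.insert_eq_of_mem h]
    · rw [toggle_of_notMem h, toggle_of_mem (by simp), Set.insert_sdiff_self_of_notMem h]
  rank_apply s := by
    by_cases h : a ∈ s
    · rw [toggle_of_mem h]
      exact Or.inr (Set.ncard_sdiff_singleton_add_one h)
    · rw [toggle_of_notMem h]
      exact Or.inl (Set.ncard_insert_of_notMem h)
  le_apply s h := by
    rw [toggle_of_notMem (ncard_lt_ncard_toggle_iff.1 h)]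
    exact Set.subset_insert a s
  le_of_le_apply s t hs ht h := by
    rw [toggle_of_notMem (ncard_lt_ncard_toggle_iff.1 ht)] at h
    exact (Set.subset_insert_iff_of_notMem (ncard_lt_ncard_toggle_iff.1 hs)).1 h
  apply_le_apply s t hs ht h := by
    rw [toggle_of_notMem (ncard_lt_ncard_toggle_iff.1 ht),
      toggle_of_notMem (ncard_lt_ncard_toggle_iff.1 hs)]
    exact Set.insert_subset_insert h

/-- Induction on the size of `t`: any `a ∈ t` gives a matching that moves `t` down, and `a` may or
may not belong to `s`. -/
theorem hasCDIndex_Icc_set {s t : Set α} (h : s ≤ t) : HasCDIndex (Set.Icc s t) := by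
  classical
  obtain ⟨n, hn⟩ : ∃ n, t.ncard = n := ⟨_, rfl⟩
  induction n using Nat.strong_induction_on generalizing s t with
  | _ n ih =>
    rcases t.eq_empty_or_nonempty with rfl | ⟨a, ha⟩
    · rw [le_antisymm h (Set.empty_subset s)]
      exact hasCDIndex_of_abIndex_eq_one ((isRankFunction_ncard α).abIndex_Icc_self _)
    have := Fintype.ofFinite (Set α)
    have hm := isSpecialMatching_toggle a
    have hlt : (toggle a t).ncard < t.ncard := by
      rw [toggle_of_mem ha]
      have := Set.ncard_sdiff_singleton_add_one ha
      omega
    have key := hasCDIndex_Icc_apply (isRankFunction_ncard α) hm (x := toggle a t) (u := s)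
      (by rw [hm.apply_apply]; exact hlt) (fun v w hw hvw =>
        ih w.ncard (((isRankFunction_ncard α).strictMono.monotone hw).trans_lt (hn ▸ hlt))
          hvw.le rfl)
      (by rw [hm.apply_apply]; exact h)
    rwa [hm.apply_apply] at key

end Boolean

/-- The Boolean algebra as an interval of a larger Boolean algebra. -/
def setFinIso (n : ℕ) : Set.Icc (∅ : Set (Fin (n + 1))) {0}ᶜ ≃o Set (Fin n) where
  toFun s := Fin.succ ⁻¹' s.1
  invFun t := ⟨Fin.succ '' t, Set.empty_subset _, by
    rintro _ ⟨i, -, rfl⟩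
    exact Fin.succ_ne_zero i⟩
  left_inv s := by
    apply Subtype.ext
    dsimp only
    rw [Set.image_preimage_eq_inter_range, Fin.range_succ]
    exact Set.inter_eq_left.2 s.2.2
  right_inv t := Set.preimage_image_eq t (Fin.succ_injective n)
  map_rel_iff' := by
    intro s t
    change Fin.succ ⁻¹' s.1 ⊆ Fin.succ ⁻¹' t.1 ↔ s.1 ⊆ t.1
    rw [Set.preimage_subset_preimage_iff]
    rw [Fin.range_succ]
    exact s.2.2

/-- A Boolean algebra as an interval. -/
def setIccIso (α : Type*) : Set.Icc (∅ : Set α) Set.univ ≃o Set α where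
  toFun s := s.1
  invFun t := ⟨t, Set.empty_subset _, Set.subset_univ _⟩
  left_inv _ := rfl
  right_inv _ := rfl
  map_rel_iff' := Iff.rfl

theorem hasCDIndex_set (α : Type*) [Finite α] : HasCDIndex (Set α) :=
  (hasCDIndex_congr (setIccIso α)).1 (hasCDIndex_Icc_set (Set.empty_subset _))

theorem cdIndex_set_of_le_one {n : ℕ} (hn : n ≤ 1) : cdIndex (Set (Fin n)) = 1 := by
  apply cdIndex_eq_of_substAB_eq
  rw [map_one, ← abIndex_congr (setIccIso (Fin n))]
  have hr := isRankFunction_ncard (Fin n)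
  interval_cases n
  · rw [show (Set.univ : Set (Fin 0)) = ∅ from Subsingleton.elim _ _, hr.abIndex_Icc_self]
  · rw [abIndex_Icc_of_rank_eq hr]
    · exact Set.empty_ssubset.2 Set.univ_nonempty
    · simp [Set.ncard_univ]

/-- Toggling `0` moves down exactly the sets containing `0`, and none of them lies below `{0}ᶜ`, so
the correction sum vanishes. For `n = 0` the base `∅ < {0}ᶜ` fails, and indeed `pyr 1 = c` differs
from the cd-index `1` of rank one. -/
theorem cdIndex_set_succ {n : ℕ} (hn : n ≠ 0) :
    cdIndex (Set (Fin (n + 1))) = pyr (cdIndex (Set (Fin n))) := by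
  classical
  have := Fintype.ofFinite (Set (Fin (n + 1)))
  have hm := isSpecialMatching_toggle (0 : Fin (n + 1))
  have h0 : toggle (0 : Fin (n + 1)) {0}ᶜ = Set.univ := by
    rw [toggle_of_notMem (by simp)]
    ext i
    simp [em]
  have key := cdIndex_Icc_apply (isRankFunction_ncard (Fin (n + 1))) hm (u := ∅) (x := {0}ᶜ)
    (ncard_lt_ncard_toggle_iff.2 (by simp)) (ncard_lt_ncard_toggle_iff.2 (by simp))
    (Set.empty_ssubset.2 ⟨Fin.succ ⟨0, Nat.pos_of_ne_zero hn⟩, Fin.succ_ne_zero _⟩)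
    (fun v w _ hvw => hasCDIndex_Icc_set hvw.le)
  rw [h0, cdIndex_congr (setIccIso _), cdIndex_congr (setFinIso n)] at key
  rw [key, Finset.sum_eq_zero, sub_zero]
  intro v hv
  have hv0 : (0 : Fin (n + 1)) ∈ v := by
    by_contra h
    exact (ncard_lt_ncard_toggle_iff.2 h).not_gt (Finset.mem_filter.1 hv).2
  have hlt : ¬ v < {0}ᶜ := fun h => h.le hv0 rfl
  rw [show cdMatrix (Set (Fin (n + 1))) v {0}ᶜ = 0 from if_neg hlt, mul_zero]

end CDIndex

/-- With `x = i * w` for a left descent `i` and `n = l(x)`, the difference splits as `pyr (Φ_{B_n} -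
Φ[1,x])` plus `pyr Φ[1,x] - Φ[1,w]`. The first is nonnegative by induction, the second by
`pyr_sub_cdIndex_mem_nonnegCD`. -/
theorem CoxeterSystem.cdIndex_set_sub_mem_nonnegCD {B W : Type*} [Group W] {M : CoxeterMatrix B}
    (cs : CoxeterSystem M W) (hnonneg : cs.CDNonneg) (w : W) :
    CDIndex.cdIndex (Set (Fin (cs.length w))) - CDIndex.cdIndex (cs.BruhatInterval 1 w) ∈
      CDIndex.nonnegCD := by
  obtain ⟨n, hn⟩ : ∃ n, cs.length w = n := ⟨_, rfl⟩
  induction n generalizing w with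
  | zero =>
    rw [cs.cdIndex_bruhatInterval_of_length_le_one (by omega),
      CDIndex.cdIndex_set_of_le_one (by omega), sub_self]
    exact zero_mem _
  | succ n ih =>
    -- Length one is a second base case, since the pyramid recursion starts only from rank one.
    rcases Nat.eq_zero_or_pos n with rfl | hpos
    · rw [cs.cdIndex_bruhatInterval_of_length_le_one (by omega),
        CDIndex.cdIndex_set_of_le_one (by omega), sub_self]
      exact zero_mem _
    have hw1 : w ≠ 1 := by rintro rfl; simp at hn
    obtain ⟨i, hi⟩ := cs.exists_leftDescent_of_ne_one hw1
    have hl : cs.length (cs.simple i * w) = n := by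
      have := cs.isLeftDescent_iff.1 hi
      omega
    have h1 := cs.pyr_sub_cdIndex_mem_nonnegCD hnonneg hi (by
      intro h
      rw [h, cs.length_one] at hl
      omega)
    have h2 := CDIndex.pyr_mem_nonnegCD (ih _ hl)
    rw [hl, map_sub] at h2
    rw [hn, CDIndex.cdIndex_set_succ hpos.ne']
    have h3 := add_mem h2 h1
    rwa [sub_add_sub_cancel] at h3

theorem mainTheorem9 {B W : Type*} [Group W] {M : CoxeterMatrix B} (cs : CoxeterSystem M W)
    (hnonneg : cs.CDNonneg) (w : W) :
    CDIndex.HasCDIndex (cs.BruhatInterval 1 w) ∧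
    CDIndex.HasCDIndex (Set (Fin (cs.length w))) ∧
    ∀ m : FreeMonoid CDIndex.CD,
      CDIndex.cdCoeff (CDIndex.cdIndex (cs.BruhatInterval 1 w)) m ≤
        CDIndex.cdCoeff (CDIndex.cdIndex (Set (Fin (cs.length w)))) m :=
  ⟨cs.hasCDIndex_bruhatInterval (cs.one_bruhatLE w), CDIndex.hasCDIndex_set _,
    CDIndex.cdCoeff_le_iff.2 (cs.cdIndex_set_sub_mem_nonnegCD hnonneg w)⟩
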